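/- Let $\mathbb K=\mathbb R$ or $\mathbb C$, let $\Omega\subseteq\mathbb K^n$ be an open neighbourhood of $0$ (for instance $\Omega=\mathbb K^n$), and let $\Pi$ be a ($\mathbb K$-)analytic Poisson structure on $\Omega$. Let $G$ be a compact real Lie group with an analytic action $(g,x)\mapsto\varphi^g(x)$ on $(\Omega,\Pi)$: the action map $G\times\Omega\to\Omega$ is real analytic, and each $\varphi^g$ is a $\mathbb K$-analytic diffeomorphism of $\Omega$ which preserves $\Pi$. Suppose that $\varphi^g(0)=0$ for all $g\in G$, and that $\Pi$ is linearizable at $0$, that is, there is a local analytic coordinate system $\chi=(x_1,\dots,x_n)$ on a neighbourhood of $0$ in $\Omega$, with $\chi(0)=0$, such that $\{x_i,x_j\}=\sum_k c_{ij}^k x_k$ with constants $c_{ij}^k\in\mathbb K$. Then the action can be linearized by a Poisson diffeomorphism. More precisely, for every such $\chi$ there are a $G$-invariant open neighbourhood $U$ of $0$, contained in the domain of $\chi$, and an analytic diffeomorphism $\psi$ from $U$ onto an open neighbourhood of $0$ contained in the domain of $\chi$, with analytic inverse and $\psi(0)=0$, such that $\psi$ preserves $\Pi$ and, in the coordinates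 $\chi$, $\psi$ conjugates the action to its linear part at $0$: $$\chi\bigl(\psi(\varphi^g(x))\bigr)=D\bigl(\chi\circ\varphi^g\circ\chi^{-1}\bigr)(0)\,\cdot\,\chi(\psi(x))\qquad\text{for all } g\in G,\ x\in U .$$ -/

import Mathlib

open scoped ContDiff Manifold

namespace LinearAction

/-- The bracket `{f, g}(x) = ∑ i j, π_ij(x) ∂_i f(x) ∂_j g(x)` of two functions on `𝕜^n` attached to a
bivector field `π = ½ ∑ i j, π_ij ∂_i ∧ ∂_j`, which is given by its matrix of components
`π_ij = {x_i, x_j}`. -/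
noncomputable def bracket {𝕜 : Type*} [RCLike 𝕜] {n : ℕ}
    (π : (Fin n → 𝕜) → Matrix (Fin n) (Fin n) 𝕜) (f g : (Fin n → 𝕜) → 𝕜) (x : Fin n → 𝕜) : 𝕜 :=
  ∑ i, ∑ j, π x i j * fderiv 𝕜 f x (Pi.single i 1) * fderiv 𝕜 g x (Pi.single j 1)

/-- `π` is an analytic Poisson structure on the open set `Ω`: an analytic bivector field whose
bracket satisfies the Jacobi identity. The Jacobi identity is stated on the coordinate functions,
whose brackets are the components of `π`; this is the vanishing of the components of the Schouten
bracket `[π, π]`. -/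
structure IsAnalyticPoisson {𝕜 : Type*} [RCLike 𝕜] {n : ℕ}
    (Ω : Set (Fin n → 𝕜)) (π : (Fin n → 𝕜) → Matrix (Fin n) (Fin n) 𝕜) : Prop where
  analytic : ∀ i j, AnalyticOnNhd 𝕜 (fun x => π x i j) Ω
  skew : ∀ x ∈ Ω, ∀ i j, π x j i = -π x i j
  jacobi : ∀ x ∈ Ω, ∀ i j k,
    bracket π (fun y => y i) (fun y => π y j k) x
      + bracket π (fun y => y j) (fun y => π y k i) x
      + bracket π (fun y => y k) (fun y => π y i j) x = 0

/-- On `U`, the map `F` sends the bivector field `π` to the bivector field `π'`: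
`{F_i, F_j}_π = {y_i, y_j}_π' ∘ F` for all coordinates `y_i`, `y_j` of the target. -/
def IsPoissonMapOn {𝕜 : Type*} [RCLike 𝕜] {n : ℕ}
    (π π' : (Fin n → 𝕜) → Matrix (Fin n) (Fin n) 𝕜) (U : Set (Fin n → 𝕜))
    (F : (Fin n → 𝕜) → (Fin n → 𝕜)) : Prop :=
  ∀ x ∈ U, ∀ i j, bracket π (fun y => F y i) (fun y => F y j) x = π' (F x) i j

/-- A local analytic diffeomorphism of `(𝕜^n, 0)`: an analytic diffeomorphism, with analytic
inverse, between two open neighbourhoods of `0`, which fixes `0`. -/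
structure IsLocalAnalyticDiffeo {𝕜 : Type*} [RCLike 𝕜] {n : ℕ}
    (ψ : OpenPartialHomeomorph (Fin n → 𝕜) (Fin n → 𝕜)) : Prop where
  zero_mem : 0 ∈ ψ.source
  map_zero : ψ 0 = 0
  analytic : AnalyticOnNhd 𝕜 ψ ψ.source
  analytic_symm : AnalyticOnNhd 𝕜 ψ.symm ψ.target

/-- The linear bivector field with structure constants `c`, i.e. `{x_i, x_j} = ∑ k, c_ij^k x_k`. -/
def linearBivector {𝕜 : Type*} [RCLike 𝕜] {n : ℕ} (c : Fin n → Fin n → Fin n → 𝕜) :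
    (Fin n → 𝕜) → Matrix (Fin n) (Fin n) 𝕜 :=
  fun x => Matrix.of fun i j => ∑ k, c i j k * x k

/-- `χ` is a local analytic coordinate system at `0`, inside `Ω`, in which `π` is linear.
The Poisson structure `π` is linearizable at `0` when such a `χ` exists. -/
structure IsLinearizingChart {𝕜 : Type*} [RCLike 𝕜] {n : ℕ}
    (Ω : Set (Fin n → 𝕜)) (π : (Fin n → 𝕜) → Matrix (Fin n) (Fin n) 𝕜)
    (χ : OpenPartialHomeomorph (Fin n → 𝕜) (Fin n → 𝕜)) : Prop where
  diffeo : IsLocalAnalyticDiffeo χ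
  source_subset : χ.source ⊆ Ω
  linear : ∃ c : Fin n → Fin n → Fin n → 𝕜, IsPoissonMapOn π (linearBivector c) χ.source χ

/-- `φ` is an analytic action of the (real) Lie group `G` on `(Ω, π)`. It is an action on `Ω`, the
action map `G × Ω → Ω` is real analytic, and every `φ g` is a `𝕜`-analytic (so holomorphic if
`𝕜 = ℂ`) map which preserves `π`. -/
structure IsAnalyticPoissonAction {𝕜 : Type*} [RCLike 𝕜] {n : ℕ}
    {V : Type*} [NormedAddCommGroup V] [NormedSpace ℝ V]
    {G : Type*} [TopologicalSpace G] [ChartedSpace V G] [Group G]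
    (Ω : Set (Fin n → 𝕜)) (π : (Fin n → 𝕜) → Matrix (Fin n) (Fin n) 𝕜)
    (φ : G → (Fin n → 𝕜) → (Fin n → 𝕜)) : Prop where
  mapsTo : ∀ g, Set.MapsTo (φ g) Ω Ω
  one : ∀ x ∈ Ω, φ 1 x = x
  mul : ∀ g h, ∀ x ∈ Ω, φ (g * h) x = φ g (φ h x)
  analytic : ContMDiffOn (𝓘(ℝ, V).prod 𝓘(ℝ, Fin n → 𝕜)) 𝓘(ℝ, Fin n → 𝕜) ω
    (fun p : G × (Fin n → 𝕜) => φ p.1 p.2) (Set.univ ×ˢ Ω)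
  analytic_each : ∀ g, AnalyticOnNhd 𝕜 (φ g) Ω
  poisson : ∀ g, IsPoissonMapOn π π Ω (φ g)

end LinearAction

/-! In the coordinates `χ` the Poisson structure is a linear family of forms `β`, and the conjugated
action `Φ` preserves it. The Euler field `y ↦ y` satisfies the Liouville identity `β (X x) a a' + β
x a a' = β x (a ∘ DX) a' + β x a (a' ∘ DX)`, that is, `L_X β = -β`. This identity is affine in `X`
and is preserved by Poisson diffeomorphisms. Hence the pullback of the Euler field by each `Φ h`
satisfies it too, still vanishes at `0` and still has linear part the identity. Averaging the
pullbacks over `G` gives an invariant field `X` with the same properties (`exists_invariant_field`).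

All eigenvalues of `DX 0` equal `1`, so there are no resonances, and `X` becomes the Euler field in
analytic coordinates `ψ` tangent to the identity (`exists_linearization_of_fderiv_eq_id`). An
analytic function `f` with `Df X = f` is homogeneous of degree one in `ψ`, hence linear in `ψ`
(`eq_fderiv_zero_comp_of_fderiv_apply_eq`). This one principle gives both conclusions. By invariance
of `X` it applies to `ψ ∘ Φ g`, so the action is linear in `ψ`. By the Liouville identity it applies
to the components of the push-forward of `β` by `ψ`; these are then linear in `ψ`, with the
derivative of `β` at `0`, so `ψ` preserves `β`.

Two analytic points need work. The average must be `𝕜`-analytic although the action is only real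
analytic in the group variable: the family of pullbacks is shown to be an analytic map into `C(G,
E)` (`exists_analyticAt_continuousMap`), and integration is continuous linear there. The
linearization is obtained from the inverse function theorem on a space of curves. -/

/-! ### Analytic families over a compact parameter space. -/

section ParametricAnalyticity

open Filter Topology
open scoped NNReal ENNReal Nat

/-- The coefficients of the power series recentred at points of a small ball satisfy a common
geometric bound. -/
theorem FormalMultilinearSeries.exists_nnnorm_changeOrigin_mul_pow_le {𝕜 E F : Type*}
    [NontriviallyNormedField 𝕜] [NormedAddCommGroup E] [NormedSpace 𝕜 E] [NormedAddCommGroup F]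
    [NormedSpace 𝕜 F] (p : FormalMultilinearSeries 𝕜 E F) {r r' : ℝ≥0}
    (h : (r + r' : ℝ≥0∞) < p.radius) :
    ∃ C : ℝ≥0, ∀ x : E, ‖x‖₊ ≤ r → ∀ k, ‖p.changeOrigin x k‖₊ * r' ^ k ≤ C := by
  have hsum := p.changeOriginSeries_summable_aux₁ h
  -- The bound is the sum of the whole double family; each fixed `k` contributes only a subfamily of
  -- it.
  refine ⟨∑' s : Σ k l : ℕ, { s : Finset (Fin (k + l)) // s.card = l },
    ‖p (s.1 + s.2.1)‖₊ * r ^ s.2.1 * r' ^ s.1, fun x hx k => ?_⟩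
  have hr : (r : ℝ≥0∞) < p.radius := lt_of_le_of_lt le_self_add h
  have hx' : (‖x‖₊ : ℝ≥0∞) < p.radius := lt_of_le_of_lt (by exact_mod_cast hx) hr
  have h1 := p.nnnorm_changeOrigin_le k hx'
  have h2 : (∑' s : Σ l : ℕ, { s : Finset (Fin (k + l)) // s.card = l },
      ‖p (k + s.1)‖₊ * ‖x‖₊ ^ s.1) ≤
      ∑' s : Σ l : ℕ, { s : Finset (Fin (k + l)) // s.card = l }, ‖p (k + s.1)‖₊ * r ^ s.1 := by
    refine Summable.tsum_le_tsum (fun s => by gcongr) (p.changeOriginSeries_summable_aux₂ hx' k)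
      (p.changeOriginSeries_summable_aux₂ hr k)
  calc ‖p.changeOrigin x k‖₊ * r' ^ k
      ≤ (∑' s : Σ l : ℕ, { s : Finset (Fin (k + l)) // s.card = l },
          ‖p (k + s.1)‖₊ * r ^ s.1) * r' ^ k := by gcongr; exact h1.trans h2
    _ = ∑' s : Σ l : ℕ, { s : Finset (Fin (k + l)) // s.card = l },
          ‖p (k + s.1)‖₊ * r ^ s.1 * r' ^ k := NNReal.tsum_mul_right _ _ |>.symm
    _ ≤ _ := NNReal.tsum_comp_le_tsum_of_inj hsum
          (i := fun s : Σ l : ℕ, { s : Finset (Fin (k + l)) // s.card = l } =>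
            (⟨k, s⟩ : Σ k l : ℕ, { s : Finset (Fin (k + l)) // s.card = l }))
          (fun _ _ hab => eq_of_heq (Sigma.mk.inj hab).2)

variable {𝕜 : Type*} [RCLike 𝕜]
  {E : Type*} [NormedAddCommGroup E] [NormedSpace 𝕜 E] [NormedSpace ℝ E] [IsScalarTower ℝ 𝕜 E]
  {F : Type*} [NormedAddCommGroup F] [NormedSpace 𝕜 F] [NormedSpace ℝ F] [IsScalarTower ℝ 𝕜 F]

/-- The iterated derivatives over `𝕜` can be computed from any real power series. -/
theorem AnalyticAt.iteratedFDeriv_eq_sum_real [CompleteSpace F] {f : E → F} {x : E}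
    (hf : AnalyticAt 𝕜 f x) {q : FormalMultilinearSeries ℝ E F} (hq : HasFPowerSeriesAt f q x)
    (k : ℕ) (v : Fin k → E) :
    iteratedFDeriv 𝕜 k f x v = ∑ σ : Equiv.Perm (Fin k), q k (fun i => v (σ i)) := by
  obtain ⟨P, r, hP⟩ := hf
  obtain ⟨r', hq⟩ := hq
  -- A `𝕜`-series of `f`, restricted to `ℝ`, is a second real series of `f`; both symmetrize to the
  -- same real iterated derivative.
  rw [← hq.iteratedFDeriv_eq_sum_of_completeSpace,
    (hP.restrictScalars (𝕜 := ℝ)).iteratedFDeriv_eq_sum_of_completeSpace,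
    hP.iteratedFDeriv_eq_sum_of_completeSpace]
  rfl

/-- Near a parameter `g₀` at which a family `Y` is jointly real analytic, the Taylor series of the
`Y g` at `0` converge on a common ball, with common bounds. -/
theorem exists_eventually_hasSum_iteratedFDeriv [CompleteSpace F]
    {V : Type*} [NormedAddCommGroup V] [NormedSpace ℝ V]
    {G : Type*} [TopologicalSpace G] (Y : G → E → F) (hY : ∀ g, AnalyticAt 𝕜 (Y g) 0)
    (g₀ : G) (κ : G → V) (hκ : ContinuousAt κ g₀) (f : V × E → F)
    (hf : AnalyticAt ℝ f (κ g₀, 0))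
    (hfY : ∀ᶠ p in 𝓝 (g₀, (0 : E)), Y p.1 p.2 = f (κ p.1, p.2)) :
    (∃ r : ℝ≥0, 0 < r ∧ ∃ C : ℝ≥0, ∀ᶠ g in 𝓝 g₀,
      (∀ k, ‖iteratedFDeriv 𝕜 k (Y g) 0‖ * r ^ k ≤ C * k !) ∧
      ∀ x : E, ‖x‖ < r →
        HasSum (fun k => (k ! : 𝕜)⁻¹ • iteratedFDeriv 𝕜 k (Y g) 0 (fun _ => x)) (Y g x)) ∧
    ∀ k v, ContinuousAt (fun g => iteratedFDeriv 𝕜 k (Y g) 0 v) g₀ := by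
  obtain ⟨p, R, hp⟩ := hf
  -- One `r₀` is spent on the displacement of the parameter, the other on the variable `x`.
  obtain ⟨r₀, hr₀, hr₀R⟩ : ∃ r₀ : ℝ≥0, 0 < r₀ ∧ (r₀ + r₀ : ℝ≥0∞) < R := by
    obtain ⟨a, ha0, haR⟩ := ENNReal.lt_iff_exists_nnreal_btwn.1 hp.r_pos
    refine ⟨a / 2, by simpa using ha0, ?_⟩
    rw [← ENNReal.coe_add, add_halves]
    exact haR
  obtain ⟨C, hC⟩ := p.exists_nnnorm_changeOrigin_mul_pow_le (hr₀R.trans_le hp.r_le)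
  set w : G → V × E := fun g => (κ g - κ g₀, 0) with hw
  -- Recentring the joint series at `(κ g, 0)` and restricting it to the directions of `E` gives a
  -- real series for `Y g` alone.
  set s : G → FormalMultilinearSeries ℝ E F := fun g =>
    (p.changeOrigin (w g)).compContinuousLinearMap (ContinuousLinearMap.inr ℝ V E) with hs
  have hwn : ∀ g, ‖w g‖₊ = ‖κ g - κ g₀‖₊ := fun g => by simp [hw, Prod.nnnorm_def]
  have hwc : ContinuousAt w g₀ := (hκ.sub continuousAt_const).prodMk continuousAt_const
  have hw0 : w g₀ = 0 := by simp [hw]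
  obtain ⟨U, hU, ε, hε, hUε⟩ : ∃ U ∈ 𝓝 g₀, ∃ ε > 0, ∀ g ∈ U, ∀ x : E, ‖x‖ < ε →
      Y g x = f (κ g, x) := by
    rw [nhds_prod_eq] at hfY
    obtain ⟨pa, hpa, pb, hpb, h⟩ := Filter.eventually_prod_iff.1 hfY
    obtain ⟨ε, hε, hb⟩ := Metric.eventually_nhds_iff.1 hpb
    exact ⟨_, hpa, ε, hε, fun g hg x hx => h hg (hb (by simpa using hx))⟩
  have hwr : ∀ᶠ g in 𝓝 g₀, ‖w g‖₊ ≤ r₀ := by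
    have : Tendsto (fun g => ‖w g‖₊) (𝓝 g₀) (𝓝 0) := by
      simpa [hw0, ContinuousAt] using hwc.nnnorm
    exact (this.eventually (gt_mem_nhds hr₀)).mono fun _ h => le_of_lt h
  set r : ℝ≥0 := min r₀ ⟨ε, hε.le⟩ with hr
  have hr0 : 0 < r := lt_min hr₀ hε
  have hsb : ∀ g, ‖w g‖₊ ≤ r₀ → ∀ k, ‖s g k‖ * r ^ k ≤ C := by
    intro g hg k
    have h1 : ‖s g k‖ ≤ ‖p.changeOrigin (w g) k‖ := by
      refine (FormalMultilinearSeries.norm_compContinuousLinearMap_le _ _ _).trans ?_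
      refine mul_le_of_le_one_right (norm_nonneg _) (pow_le_one₀ (norm_nonneg _) ?_)
      refine ContinuousLinearMap.opNorm_le_bound _ zero_le_one fun x => ?_
      simp [Prod.norm_def]
    calc ‖s g k‖ * r ^ k ≤ ‖p.changeOrigin (w g) k‖ * r₀ ^ k := by
          gcongr; exact min_le_left _ _
      _ ≤ C := by exact_mod_cast hC (w g) hg k
  have hser : ∀ g ∈ U, ‖w g‖₊ ≤ r₀ → HasFPowerSeriesOnBall (Y g) (s g) 0 r := by
    intro g hgU hg
    refine ⟨FormalMultilinearSeries.le_radius_of_bound _ C (hsb g hg), by exact_mod_cast hr0, ?_⟩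
    intro y hy
    have hyr : ‖y‖ < r := by simpa using hy
    have hyr' : ‖y‖₊ < r := hyr
    have hwR : (‖w g‖₊ : ℝ≥0∞) < R :=
      lt_of_le_of_lt (by exact_mod_cast hg) (lt_of_le_of_lt le_self_add hr₀R)
    have hch := hp.changeOrigin (y := w g) hwR
    have := hch.hasSum (y := ((0 : V), y)) (by
      rw [mem_eball_zero_iff, lt_tsub_iff_right]
      refine lt_of_le_of_lt ?_ hr₀R
      refine add_le_add ?_ (by exact_mod_cast hg)
      have : ‖((0 : V), y)‖₊ ≤ r₀ := by
        simpa [Prod.nnnorm_def] using hyr'.le.trans (min_le_left _ _)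
      exact_mod_cast this)
    have e : (κ g₀, (0 : E)) + w g + ((0 : V), y) = (κ g, y) := by simp [hw]
    rw [e] at this
    rw [zero_add, hUε g hgU y (lt_of_lt_of_le (by exact_mod_cast hyr') (min_le_right r₀ _))]
    exact this
  have hgood : ∀ᶠ g in 𝓝 g₀, HasFPowerSeriesOnBall (Y g) (s g) 0 r ∧ ‖w g‖₊ ≤ r₀ := by
    filter_upwards [hU, hwr] with g h1 h2 using ⟨hser g h1 h2, h2⟩
  have hD : ∀ g, HasFPowerSeriesOnBall (Y g) (s g) 0 r → ∀ k v, iteratedFDeriv 𝕜 k (Y g) 0 v =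
      ∑ σ : Equiv.Perm (Fin k), s g k (fun i => v (σ i)) := fun g hg k v =>
    (hY g).iteratedFDeriv_eq_sum_real hg.hasFPowerSeriesAt k v
  refine ⟨⟨r, hr0, C, ?_⟩, ?_⟩
  · filter_upwards [hgood] with g ⟨hg, hgr⟩
    refine ⟨fun k => ?_, fun x hx => ?_⟩
    -- The factorial counts the permutations in the symmetrization.
    · have : ‖iteratedFDeriv 𝕜 k (Y g) 0‖ ≤ k ! * ‖s g k‖ := by
        refine ContinuousMultilinearMap.opNorm_le_bound (by positivity) fun v => ?_
        rw [hD g hg]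
        refine (norm_sum_le _ _).trans ?_
        refine (Finset.sum_le_card_nsmul _ _ (‖s g k‖ * ∏ i, ‖v i‖) fun σ _ => ?_).trans ?_
        · refine ((s g k).le_opNorm _).trans_eq ?_
          rw [Equiv.prod_comp σ (fun i => ‖v i‖)]
        · simp [Fintype.card_perm, mul_assoc]
      calc ‖iteratedFDeriv 𝕜 k (Y g) 0‖ * r ^ k ≤ k ! * ‖s g k‖ * r ^ k := by gcongr
        _ = k ! * (‖s g k‖ * r ^ k) := by ring
        _ ≤ k ! * C := by gcongr; exact hsb g hgr k
        _ = C * k ! := mul_comm _ _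
    · have hx' : x ∈ Metric.eball (0 : E) r := by
        rw [mem_eball_zero_iff]
        exact_mod_cast (show ‖x‖₊ < r from hx)
      have := hg.hasSum hx'
      rw [zero_add] at this
      convert this using 2 with k
      rw [hD g hg, Finset.sum_const, Finset.card_univ, Fintype.card_perm, Fintype.card_fin,
        ← Nat.cast_smul_eq_nsmul 𝕜, smul_smul, inv_mul_cancel₀, one_smul]
      exact_mod_cast k.factorial_ne_zero
  · intro k v
    have hc : ContinuousAt (fun g => ∑ σ : Equiv.Perm (Fin k), s g k (fun i => v (σ i))) g₀ := by
      have h1 : ContinuousAt (fun g => p.changeOrigin (w g) k) g₀ := by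
        refine ContinuousAt.comp (g := fun y => p.changeOrigin y k) ?_ hwc
        rw [hw0]
        exact (p.analyticAt_changeOrigin (hp.r_pos.trans_le hp.r_le) k).continuousAt
      refine tendsto_finsetSum _ fun σ _ => ?_
      exact ((ContinuousMultilinearMap.apply ℝ (fun _ : Fin k => V × E) F
        (fun i => ((0 : V), v (σ i)))).continuous.continuousAt).comp h1
    exact hc.congr (by filter_upwards [hgood] with g hg using (hD g hg.1 k v).symm)

/-- A family `Y` of analytic maps, parametrized by a compact space and jointly real analytic near
`0`, is an analytic map into the space of continuous functions of the parameter. -/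
theorem exists_analyticAt_continuousMap [CompleteSpace F]
    {V : Type*} [NormedAddCommGroup V] [NormedSpace ℝ V]
    {G : Type*} [TopologicalSpace G] [CompactSpace G] (Y : G → E → F)
    (hY : ∀ g, AnalyticAt 𝕜 (Y g) 0)
    (hloc : ∀ g₀, ∃ κ : G → V, ContinuousAt κ g₀ ∧ ∃ f : V × E → F, AnalyticAt ℝ f (κ g₀, 0) ∧
      ∀ᶠ p in 𝓝 (g₀, (0 : E)), Y p.1 p.2 = f (κ p.1, p.2)) :
    ∃ Ξ : E → C(G, F), AnalyticAt 𝕜 Ξ 0 ∧ ∀ᶠ x in 𝓝 0, ∀ g, Ξ x g = Y g x := by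
  have hcont : ∀ k v, Continuous (fun g => iteratedFDeriv 𝕜 k (Y g) 0 v) := by
    refine fun k v => continuous_iff_continuousAt.2 fun g₀ => ?_
    obtain ⟨κ, hκ, f, hf, hfY⟩ := hloc g₀
    exact (exists_eventually_hasSum_iteratedFDeriv Y hY g₀ κ hκ f hf hfY).2 k v
  obtain ⟨r, hr, C, hrC⟩ : ∃ r : ℝ≥0, 0 < r ∧ ∃ C : ℝ≥0, ∀ g ∈ (Set.univ : Set G),
      (∀ k, ‖iteratedFDeriv 𝕜 k (Y g) 0‖ * r ^ k ≤ C * k !) ∧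
      ∀ x : E, ‖x‖ < r →
        HasSum (fun k => (k ! : 𝕜)⁻¹ • iteratedFDeriv 𝕜 k (Y g) 0 (fun _ => x)) (Y g x) := by
    -- The local radius and constant are made uniform in `g` by compactness: a union takes the
    -- smaller radius and the larger constant.
    refine isCompact_univ.induction_on (p := fun S => ∃ r : ℝ≥0, 0 < r ∧ ∃ C : ℝ≥0, ∀ g ∈ S,
      (∀ k, ‖iteratedFDeriv 𝕜 k (Y g) 0‖ * r ^ k ≤ C * k !) ∧
      ∀ x : E, ‖x‖ < r →
        HasSum (fun k => (k ! : 𝕜)⁻¹ • iteratedFDeriv 𝕜 k (Y g) 0 (fun _ => x)) (Y g x))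
      ⟨1, one_pos, 0, by simp⟩ ?_ ?_ ?_
    · rintro S T hST ⟨r, hr, C, h⟩
      exact ⟨r, hr, C, fun g hg => h g (hST hg)⟩
    · rintro S T ⟨r, hr, C, h⟩ ⟨r', hr', C', h'⟩
      have key : ∀ (ρ ρ' : ℝ≥0) (D D' : ℝ≥0), ρ' ≤ ρ → D ≤ D' → ∀ g,
          ((∀ k, ‖iteratedFDeriv 𝕜 k (Y g) 0‖ * ρ ^ k ≤ D * k !) ∧ ∀ x : E, ‖x‖ < ρ →
            HasSum (fun k => (k ! : 𝕜)⁻¹ • iteratedFDeriv 𝕜 k (Y g) 0 (fun _ => x)) (Y g x)) →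
          ((∀ k, ‖iteratedFDeriv 𝕜 k (Y g) 0‖ * ρ' ^ k ≤ D' * k !) ∧ ∀ x : E, ‖x‖ < ρ' →
            HasSum (fun k => (k ! : 𝕜)⁻¹ • iteratedFDeriv 𝕜 k (Y g) 0 (fun _ => x))
              (Y g x)) := by
        rintro ρ ρ' D D' hρ hD g ⟨h1, h2⟩
        refine ⟨fun k => ?_, fun x hx => h2 x (lt_of_lt_of_le hx (by exact_mod_cast hρ))⟩
        calc ‖iteratedFDeriv 𝕜 k (Y g) 0‖ * (ρ' : ℝ) ^ k
            ≤ ‖iteratedFDeriv 𝕜 k (Y g) 0‖ * (ρ : ℝ) ^ k := by gcongr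
          _ ≤ D * k ! := h1 k
          _ ≤ D' * k ! := by gcongr
      refine ⟨min r r', lt_min hr hr', max C C', fun g hg => ?_⟩
      rcases hg with hg | hg
      · exact key _ _ _ _ (min_le_left _ _) (le_max_left _ _) g (h g hg)
      · exact key _ _ _ _ (min_le_right _ _) (le_max_right _ _) g (h' g hg)
    · intro g₀ _
      obtain ⟨κ, hκ, f, hf, hfY⟩ := hloc g₀
      obtain ⟨r, hr, C, h⟩ := (exists_eventually_hasSum_iteratedFDeriv Y hY g₀ κ hκ f hf hfY).1
      exact ⟨_, mem_nhdsWithin_of_mem_nhds h, r, hr, C, fun g hg => hg⟩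
  have hbd : ∀ k g (v : Fin k → E), ‖(k ! : 𝕜)⁻¹ • iteratedFDeriv 𝕜 k (Y g) 0 v‖ ≤
      C / r ^ k * ∏ i, ‖v i‖ := by
    intro k g v
    have h1 := (hrC g trivial).1 k
    have h2 : ‖iteratedFDeriv 𝕜 k (Y g) 0‖ ≤ C * k ! / r ^ k := by
      rwa [le_div_iff₀ (by positivity)]
    have hk : (0 : ℝ) < k ! := by positivity
    rw [norm_smul, norm_inv, RCLike.norm_natCast]
    calc (k ! : ℝ)⁻¹ * ‖iteratedFDeriv 𝕜 k (Y g) 0 v‖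
        ≤ (k ! : ℝ)⁻¹ * (C * k ! / r ^ k * ∏ i, ‖v i‖) := by
          gcongr
          exact ((iteratedFDeriv 𝕜 k (Y g) 0).le_opNorm v).trans (by gcongr)
      _ = C / r ^ k * ∏ i, ‖v i‖ := by field_simp
  -- The Taylor coefficients depend continuously on `g` with a uniform geometric bound, so they form
  -- a convergent series over `𝕜` with values in `C(G, F)`.
  let Q : FormalMultilinearSeries 𝕜 E C(G, F) := fun k =>
    MultilinearMap.mkContinuous
      { toFun := fun v => ⟨fun g => (k ! : 𝕜)⁻¹ • iteratedFDeriv 𝕜 k (Y g) 0 v,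
          (hcont k v).const_smul _⟩
        map_update_add' := fun v i x y => by
          ext g
          simp only [ContinuousMap.coe_mk, ContinuousMap.add_apply, ← smul_add]
          rw [ContinuousMultilinearMap.map_update_add]
        map_update_smul' := fun v i c x => by
          ext g
          simp only [ContinuousMap.coe_mk, ContinuousMap.smul_apply]
          rw [ContinuousMultilinearMap.map_update_smul, smul_comm] }
      (C / r ^ k) (fun v => by
        rw [ContinuousMap.norm_le _ (by positivity)]
        exact fun g => hbd k g v)
  have hQr : (r : ℝ≥0∞) ≤ Q.radius := by
    refine Q.le_radius_of_bound C fun k => ?_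
    have : ‖Q k‖ ≤ C / r ^ k := MultilinearMap.mkContinuous_norm_le _ (by positivity) _
    rwa [le_div_iff₀ (by positivity)] at this
  have hpos : 0 < Q.radius := lt_of_lt_of_le (by exact_mod_cast hr) hQr
  have hQ := Q.hasFPowerSeriesOnBall hpos
  refine ⟨Q.sum, hQ.analyticAt, ?_⟩
  filter_upwards [Metric.ball_mem_nhds (0 : E) (show (0 : ℝ) < r from hr)] with x hx g
  have hx' : ‖x‖ < r := by simpa using hx
  have h1 := hQ.hasSum (y := x) (by
    rw [mem_eball_zero_iff]
    exact lt_of_lt_of_le (by exact_mod_cast (show ‖x‖₊ < r from hx')) hQr)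
  rw [zero_add] at h1
  have h2 : HasSum (fun k => (Q k fun _ => x) g) (Q.sum x g) :=
    h1.map (ContinuousMap.evalCLM 𝕜 g) (ContinuousMap.evalCLM 𝕜 g).continuous
  exact h2.unique ((hrC g trivial).2 x hx')

end ParametricAnalyticity

/-! ### Operators on the space of curves used to linearize a vector field. -/

section Linearization

open Filter Topology Set
open scoped NNReal ENNReal unitInterval

variable {𝕜 : Type*} [RCLike 𝕜]
  {E : Type*} [NormedAddCommGroup E] [NormedSpace 𝕜 E]
  {F : Type*} [NormedAddCommGroup F] [NormedSpace 𝕜 F]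

/-- The Volterra operator `γ ↦ ∫₀ γ` on continuous curves. -/
noncomputable def volterra (𝕜 : Type*) [RCLike 𝕜] (E : Type*) [NormedAddCommGroup E]
    [NormedSpace 𝕜 E] [NormedSpace ℝ E] [IsScalarTower ℝ 𝕜 E] : C(I, E) →L[𝕜] C(I, E) :=
  LinearMap.mkContinuous
    { toFun := fun γ => ⟨fun s => ∫ τ in (0 : ℝ)..s, γ (projIcc 0 1 zero_le_one τ), by
        refine (intervalIntegral.continuous_primitive (fun a b => ?_) 0).comp
          continuous_subtype_val
        exact (γ.continuous.comp continuous_projIcc).intervalIntegrable _ _⟩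
      map_add' := fun γ δ => by
        ext s
        exact intervalIntegral.integral_add
          ((γ.continuous.comp continuous_projIcc).intervalIntegrable _ _)
          ((δ.continuous.comp continuous_projIcc).intervalIntegrable _ _)
      map_smul' := fun c γ => by
        ext s
        exact intervalIntegral.integral_smul c _ }
    1 (fun γ => by
      rw [one_mul, ContinuousMap.norm_le _ (norm_nonneg _)]
      intro s
      refine (intervalIntegral.norm_integral_le_of_norm_le_const
        (fun τ _ => γ.norm_coe_le_norm _)).trans ?_
      rw [sub_zero, abs_of_nonneg s.2.1]
      exact mul_le_of_le_one_right (norm_nonneg _) s.2.2)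

theorem volterra_apply [NormedSpace ℝ E] [IsScalarTower ℝ 𝕜 E] (γ : C(I, E)) (s : I) :
    volterra 𝕜 E γ s = ∫ τ in (0 : ℝ)..s, γ (projIcc 0 1 zero_le_one τ) := rfl

/-- The power series, on curves, of the superposition operator `γ ↦ (τ ↦ f (τ γ(τ)) / τ²)` attached
to a function `f` which vanishes to second order and has power series `q`. -/
noncomputable def rescaledSeries (q : FormalMultilinearSeries 𝕜 E E) :
    FormalMultilinearSeries 𝕜 C(I, E) C(I, E) := fun k =>
  MultilinearMap.mkContinuous
    -- For `k = 0, 1` the truncated exponent is `0`; this is harmless when `q 0` and `q 1` vanish.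
    { toFun := fun γ => ⟨fun τ => ((τ : ℝ) : 𝕜) ^ (k - 2) • q k (fun i => γ i τ), by
        have : Continuous fun τ : I => ((τ : ℝ) : 𝕜) ^ (k - 2) :=
          (RCLike.continuous_ofReal.comp continuous_subtype_val).pow _
        exact this.smul ((q k).cont.comp (continuous_pi fun i => (γ i).continuous))⟩
      map_update_add' := fun γ i x y => by
        ext τ
        have h : ∀ z : C(I, E), (fun j => Function.update γ i z j τ) =
            Function.update (fun j => γ j τ) i (z τ) := fun z => by
          ext j; rcases eq_or_ne j i with rfl | hj <;> simp [*]
        simp [h, smul_add]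
      map_update_smul' := fun γ i c x => by
        ext τ
        have h : ∀ z : C(I, E), (fun j => Function.update γ i z j τ) =
            Function.update (fun j => γ j τ) i (z τ) := fun z => by
          ext j; rcases eq_or_ne j i with rfl | hj <;> simp [*]
        simp [h, smul_comm c] }
    ‖q k‖ (fun γ => by
      rw [ContinuousMap.norm_le _ (by positivity)]
      intro τ
      change ‖((τ : ℝ) : 𝕜) ^ (k - 2) • q k (fun i => γ i τ)‖ ≤ _
      rw [norm_smul, norm_pow, RCLike.norm_ofReal, abs_of_nonneg τ.2.1]
      refine (mul_le_of_le_one_left (norm_nonneg _) (pow_le_one₀ τ.2.1 τ.2.2)).trans ?_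
      refine ((q k).le_opNorm _).trans ?_
      gcongr with i
      exact (γ i).norm_coe_le_norm τ)

theorem rescaledSeries_apply (q : FormalMultilinearSeries 𝕜 E E) (k : ℕ) (γ : Fin k → C(I, E))
    (τ : I) :
    rescaledSeries q k γ τ = ((τ : ℝ) : 𝕜) ^ (k - 2) • q k (fun i => γ i τ) := rfl

theorem radius_le_radius_rescaledSeries (q : FormalMultilinearSeries 𝕜 E E) :
    q.radius ≤ (rescaledSeries q).radius :=
  FormalMultilinearSeries.radius_le_of_le fun _ =>
    MultilinearMap.mkContinuous_norm_le _ (norm_nonneg _) _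

/-- The curve `s ↦ t γ(ts)`. -/
noncomputable def rescaledCurve (𝕜 : Type*) [RCLike 𝕜] [NormedSpace 𝕜 E] (t : I) (γ : C(I, E)) :
    C(I, E) :=
  ⟨fun s => ((t : ℝ) : 𝕜) • γ (t * s), (γ.continuous.comp (by fun_prop)).const_smul _⟩

theorem rescaledCurve_apply (t : I) (γ : C(I, E)) (s : I) :
    rescaledCurve 𝕜 t γ s = ((t : ℝ) : 𝕜) • γ (t * s) := rfl

theorem norm_rescaledCurve_le (t : I) (γ : C(I, E)) : ‖rescaledCurve 𝕜 t γ‖ ≤ ‖γ‖ := by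
  rw [ContinuousMap.norm_le _ (norm_nonneg _)]
  intro s
  rw [rescaledCurve_apply, norm_smul, RCLike.norm_ofReal, abs_of_nonneg t.2.1]
  exact (mul_le_of_le_one_left (norm_nonneg _) t.2.2).trans (γ.norm_coe_le_norm _)

theorem rescaledSeries_hasSum_apply [CompleteSpace E] {q : FormalMultilinearSeries 𝕜 E E}
    {γ : C(I, E)} (hγ : ‖γ‖ₑ < q.radius) (τ : I) :
    HasSum (fun k => ((τ : ℝ) : 𝕜) ^ (k - 2) • q k (fun _ => γ τ))
      ((rescaledSeries q).sum γ τ) := by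
  have h1 := (rescaledSeries q).hasSum (x := γ)
    (mem_eball_zero_iff.2 (hγ.trans_le (radius_le_radius_rescaledSeries q)))
  exact h1.map (ContinuousMap.evalCLM 𝕜 τ) (ContinuousMap.evalCLM 𝕜 τ).continuous

/-- In degree `k ≥ 2`, `s ^ (k - 2) * t ^ k = t ^ 2 * (t * s) ^ (k - 2)`. This homogeneity makes the
integral equation for curves invariant under rescaling. -/
theorem rescaledSeries_sum_rescaledCurve [CompleteSpace E] {q : FormalMultilinearSeries 𝕜 E E}
    (h0 : q 0 = 0) (h1 : q 1 = 0) {γ : C(I, E)} (hγ : ‖γ‖ₑ < q.radius) (t s : I) :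
    (rescaledSeries q).sum (rescaledCurve 𝕜 t γ) s =
      ((t : ℝ) : 𝕜) ^ 2 • (rescaledSeries q).sum γ (t * s) := by
  have hγ' : ‖rescaledCurve 𝕜 t γ‖ₑ < q.radius :=
    lt_of_le_of_lt (enorm_le_iff_norm_le.2 (norm_rescaledCurve_le t γ)) hγ
  refine (rescaledSeries_hasSum_apply hγ' s).unique ?_
  convert! (rescaledSeries_hasSum_apply hγ (t * s)).const_smul (((t : ℝ) : 𝕜) ^ 2) using 2 with k
  rcases k with _ | _ | k
  · simp [h0]
  · simp [h1]
  · have : (fun _ : Fin (k + 1 + 1) => rescaledCurve 𝕜 t γ s) =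
        fun i => (fun _ => ((t : ℝ) : 𝕜)) i • (fun _ => γ (t * s)) i := rfl
    rw [this, ContinuousMultilinearMap.map_smul_univ, Finset.prod_const, Finset.card_univ,
      Fintype.card_fin, smul_smul, smul_smul]
    congr 1
    simp only [Icc.coe_mul, RCLike.ofReal_mul]
    rw [show k + 1 + 1 - 2 = k by omega]
    ring

/-- The substitution `τ ↦ t τ` absorbs one of the two factors `t`. -/
theorem volterra_rescaledCurve [NormedSpace ℝ E] [IsScalarTower ℝ 𝕜 E] (t s : I) (ν μ : C(I, E))
    (h : ∀ s, μ s = ((t : ℝ) : 𝕜) ^ 2 • ν (t * s)) :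
    volterra 𝕜 E μ s = ((t : ℝ) : 𝕜) • volterra 𝕜 E ν (t * s) := by
  rw [volterra_apply, volterra_apply]
  have e : ∀ τ ∈ uIcc (0 : ℝ) s, μ (projIcc 0 1 zero_le_one τ) =
      (t : ℝ) ^ 2 • ν (projIcc 0 1 zero_le_one (t * τ)) := by
    intro τ hτ
    rw [uIcc_of_le s.2.1] at hτ
    have hτ1 : τ ∈ Icc (0 : ℝ) 1 := ⟨hτ.1, hτ.2.trans s.2.2⟩
    have : projIcc (0 : ℝ) 1 zero_le_one (t * τ) = t * projIcc 0 1 zero_le_one τ := by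
      have hm : (t : ℝ) * τ ∈ Icc (0 : ℝ) 1 :=
        ⟨mul_nonneg t.2.1 hτ1.1, mul_le_one₀ t.2.2 hτ1.1 hτ1.2⟩
      rw [projIcc_of_mem _ hm, projIcc_of_mem _ hτ1]
      rfl
    rw [h, this, ← RCLike.ofReal_pow, RCLike.real_smul_eq_coe_smul (K := 𝕜)]
  rw [intervalIntegral.integral_congr e, intervalIntegral.integral_smul, pow_two, mul_smul,
    ← RCLike.real_smul_eq_coe_smul (K := 𝕜)]
  congr 1
  rw [intervalIntegral.smul_integral_comp_mul_left
    (fun τ => ν (projIcc (0 : ℝ) 1 zero_le_one τ)), mul_zero, Icc.coe_mul]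

theorem hasDerivAt_smul_add_primitive [NormedSpace ℝ E] [CompleteSpace E] (y : E) (ν : C(I, E)) :
    HasDerivAt (fun t : ℝ => t • (y + ∫ τ in (0 : ℝ)..t, ν (projIcc 0 1 zero_le_one τ)))
      (y + (∫ τ in (0 : ℝ)..1, ν (projIcc 0 1 zero_le_one τ)) + ν 1) 1 := by
  have hc : Continuous fun τ : ℝ => ν (projIcc 0 1 zero_le_one τ) :=
    ν.continuous.comp continuous_projIcc
  have h1 := (hc.integral_hasStrictDerivAt 0 1).hasDerivAt.const_add y
  have h2 := (hasDerivAt_id (1 : ℝ)).smul h1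
  simp only [id, one_smul, projIcc_right] at h2
  convert! h2 using 1
  rw [add_comm]
  rfl

end Linearization

/-! ### Poincaré linearization, and linearity of eigenfunctions of the Euler field. -/

section Linearization

open Filter Topology Set
open scoped NNReal ENNReal unitInterval

variable {𝕜 : Type*} [RCLike 𝕜]
  {E : Type*} [NormedAddCommGroup E] [NormedSpace 𝕜 E]
  {F : Type*} [NormedAddCommGroup F] [NormedSpace 𝕜 F]

/-- If `f` vanishes to second order at `0`, the equation `Dη(y) y = η(y) + f(η(y))` has an analytic
solution `η` tangent to the identity. -/
theorem exists_analyticAt_fderiv_apply_self_eq [CompleteSpace E] [NormedSpace ℝ E]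
    [IsScalarTower ℝ 𝕜 E] {f : E → E}
    (hf : AnalyticAt 𝕜 f 0) (hf0 : f 0 = 0) (hf1 : fderiv 𝕜 f 0 = 0) :
    ∃ η : E → E, AnalyticAt 𝕜 η 0 ∧ η 0 = 0 ∧ fderiv 𝕜 η 0 = ContinuousLinearMap.id 𝕜 E ∧
      ∀ᶠ y in 𝓝 0, fderiv 𝕜 η y y = η y + f (η y) := by
  obtain ⟨q, r, hq⟩ := hf
  have hq0 : q 0 = 0 := by
    ext v
    rw [hq.coeff_zero, hf0]; rfl
  have hq1 : q 1 = 0 := by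
    have := hq.hasFPowerSeriesAt.fderiv_eq
    rw [hf1] at this
    exact (continuousMultilinearCurryFin1 𝕜 E E).injective (by rw [map_zero]; exact this.symm)
  set N := rescaledSeries q with hN
  have hrad : 0 < N.radius :=
    (hq.r_pos.trans_le hq.r_le).trans_le (radius_le_radius_rescaledSeries q)
  have hNs := N.hasFPowerSeriesOnBall hrad
  have hN0 : N.sum 0 = 0 := by
    rw [← hNs.coeff_zero (fun _ => 0)]
    ext τ
    simp [hN, rescaledSeries_apply, hq0]
  have hN1 : HasFDerivAt N.sum (0 : C(I, E) →L[𝕜] C(I, E)) 0 := by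
    have := hNs.hasFPowerSeriesAt.hasFDerivAt
    convert! this
    symm
    ext γ τ
    simp [hN, rescaledSeries_apply, hq1]
  -- If `η` solves the equation, `γ(s) = η(sy) / s` satisfies `γ' = f(sγ) / s²` and `γ(0) = y`, that
  -- is, `H γ` is the constant curve `y`. As `DH(0) = 1`, the inverse function theorem solves this
  -- analytically in `y`; then `η(y) = γ(1)`.
  set H : C(I, E) → C(I, E) := fun γ => γ - volterra 𝕜 E (N.sum γ) with hH
  have hHa : AnalyticAt 𝕜 H 0 :=
    analyticAt_id.sub (((volterra 𝕜 E).analyticAt _).comp hNs.analyticAt)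
  have hH0 : H 0 = 0 := by simp [hH, hN0]
  have hH1 : HasFDerivAt H
      ((ContinuousLinearEquiv.refl 𝕜 C(I, E) : C(I, E) ≃L[𝕜] C(I, E)) : C(I, E) →L[𝕜] C(I, E))
      0 := by
    have := (hasFDerivAt_id (0 : C(I, E))).sub
      ((volterra 𝕜 E).hasFDerivAt.comp (0 : C(I, E)) hN1)
    convert! this using 1
    ext; simp
  have hHc : ContDiffAt 𝕜 ω H 0 := hHa.contDiffAt
  set e := hHc.toOpenPartialHomeomorph H hH1 (by simp) with he
  have he0 : (0 : C(I, E)) ∈ e.source := hHc.mem_toOpenPartialHomeomorph_source hH1 (by simp)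
  have heH : ∀ γ, e γ = H γ := fun _ => rfl
  have hes0 : e.symm 0 = 0 := by
    conv_lhs => rw [← hH0, ← heH]
    exact e.left_inv he0
  have het0 : (0 : C(I, E)) ∈ e.target := by
    have := e.map_source he0
    rwa [heH, hH0] at this
  have hesa : AnalyticAt 𝕜 e.symm 0 := by
    have := e.analyticAt_symm (i := ContinuousLinearEquiv.refl 𝕜 C(I, E)) het0
      (by rw [hes0]; exact hHa) (by rw [hes0]; exact hH1.fderiv)
    exact this
  have hes1 : HasFDerivAt e.symm (ContinuousLinearMap.id 𝕜 C(I, E)) 0 := by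
    have := e.hasFDerivAt_symm (f' := ContinuousLinearEquiv.refl 𝕜 C(I, E)) het0
      (by rw [hes0]; exact hH1)
    exact this
  set c : E →L[𝕜] C(I, E) := ContinuousLinearMap.const 𝕜 I with hc
  have hcy : ∀ y s, c y s = y := fun _ _ => rfl
  set K : E → C(I, E) := fun y => e.symm (c y) with hK
  have hKa : AnalyticAt 𝕜 K 0 :=
    AnalyticAt.comp (g := e.symm) (by rw [map_zero]; exact hesa) (c.analyticAt 0)
  have hK0 : K 0 = 0 := by simp [hK, hes0]
  set ev : C(I, E) →L[𝕜] E := ContinuousMap.evalCLM 𝕜 1 with hev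
  have hevγ : ∀ γ, ev γ = γ 1 := fun _ => rfl
  refine ⟨fun y => ev (K y), (ev.analyticAt _).comp hKa, by simp [hK0], ?_, ?_⟩
  · have h1 : HasFDerivAt K ((ContinuousLinearMap.id 𝕜 C(I, E)).comp c) 0 :=
      HasFDerivAt.comp (g := e.symm) 0 (by rw [map_zero]; exact hes1) c.hasFDerivAt
    have h2 : HasFDerivAt (fun y => ev (K y)) _ (0 : E) := ev.hasFDerivAt.comp (0 : E) h1
    rw [h2.fderiv]
    ext y
    simp [hevγ, hcy]
  obtain ⟨δ, hδ, hball⟩ := Metric.mem_nhds_iff.1 (e.open_source.mem_nhds he0)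
  have hηa : AnalyticAt 𝕜 (fun y => ev (K y)) 0 := (ev.analyticAt _).comp hKa
  have ev1 : ∀ᶠ y in 𝓝 (0 : E), c y ∈ e.target :=
    c.continuous.continuousAt.eventually (by rw [map_zero]; exact e.open_target.mem_nhds het0)
  have ev2 : ∀ᶠ y in 𝓝 (0 : E), K y ∈ Metric.ball 0 δ :=
    hKa.continuousAt.eventually (by rw [hK0]; exact Metric.ball_mem_nhds _ hδ)
  have ev3 : ∀ᶠ y in 𝓝 (0 : E), K y ∈ Metric.eball 0 r :=
    hKa.continuousAt.eventually (by rw [hK0]; exact Metric.eball_mem_nhds _ hq.r_pos)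
  filter_upwards [ev1, ev2, ev3, hηa.eventually_analyticAt] with y hy1 hy2 hy3 hy4
  have hyr : ‖K y‖ₑ < r := mem_eball_zero_iff.1 hy3
  have hyq : ‖K y‖ₑ < q.radius := hyr.trans_le hq.r_le
  have hHK : H (K y) = c y := e.right_inv hy1
  have hKs : ∀ s, K y s = y + volterra 𝕜 E (N.sum (K y)) s := fun s => by
    have := congrArg (fun γ : C(I, E) => γ s) hHK
    simp only [hH, ContinuousMap.sub_apply, hcy] at this
    exact sub_eq_iff_eq_add.1 this
  -- Both sides have the same image under `H`, the constant curve `t y`. Rescaling does not increase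
  -- the norm, so the rescaled curve stays in the ball where `H` is injective.
  have hscale : ∀ t : I, K (((t : ℝ) : 𝕜) • y) = rescaledCurve 𝕜 t (K y) := by
    intro t
    have hmem : rescaledCurve 𝕜 t (K y) ∈ e.source :=
      hball (mem_ball_zero_iff.2 ((norm_rescaledCurve_le t _).trans_lt (mem_ball_zero_iff.1 hy2)))
    rw [← e.left_inv hmem]
    change e.symm _ = e.symm _
    congr 1
    ext s
    rw [hcy, heH]
    simp only [hH, ContinuousMap.sub_apply]
    rw [volterra_rescaledCurve t s (N.sum (K y)) _
      (rescaledSeries_sum_rescaledCurve hq0 hq1 hyq t), rescaledCurve_apply, hKs]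
    simp
  have hd1 : HasDerivAt (fun t : ℝ => ev (K ((t : 𝕜) • y)))
      (fderiv 𝕜 (fun y => ev (K y)) y y) 1 := by
    have h1 : HasFDerivAt (fun y => ev (K y)) ((fderiv 𝕜 (fun y => ev (K y)) y).restrictScalars ℝ)
        (((1 : ℝ) : 𝕜) • y) := by
      rw [RCLike.ofReal_one, one_smul]
      exact hy4.differentiableAt.hasFDerivAt.restrictScalars ℝ
    have h2 : HasDerivAt (fun t : ℝ => (t : 𝕜) • y) y 1 := by
      have := (hasDerivAt_id (1 : ℝ)).smul_const y
      simpa only [id, one_smul, RCLike.real_smul_eq_coe_smul (K := 𝕜), RCLike.ofReal_one] using this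
    exact h1.comp_hasDerivAt (1 : ℝ) h2
  have hd2 := hasDerivAt_smul_add_primitive y (N.sum (K y))
  have heq : ∀ t ∈ Icc (0 : ℝ) 1, ev (K ((t : 𝕜) • y)) =
      t • (y + ∫ τ in (0 : ℝ)..t, (N.sum (K y)) (projIcc 0 1 zero_le_one τ)) := by
    intro t ht
    have := hscale ⟨t, ht⟩
    rw [hevγ, this, rescaledCurve_apply, mul_one, hKs, volterra_apply,
      RCLike.real_smul_eq_coe_smul (K := 𝕜)]
  have h1mem : (1 : ℝ) ∈ Icc (0 : ℝ) 1 := ⟨zero_le_one, le_rfl⟩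
  have hd3 := hd2.hasDerivWithinAt (s := Icc 0 1) |>.congr heq (heq 1 h1mem)
  -- The formula for `η(ty)` is known only for `t ≤ 1`, so the two derivatives at `1` are compared
  -- within `Icc 0 1`.
  have huniq := (uniqueDiffOn_Icc (zero_lt_one' ℝ) 1 h1mem).eq_deriv _ hd1.hasDerivWithinAt hd3
  rw [huniq]
  have hone : (N.sum (K y)) 1 = f (K y 1) := by
    have h1 := rescaledSeries_hasSum_apply hyq 1
    have h2 := hq.hasSum (y := K y 1) (mem_eball_zero_iff.2
      (lt_of_le_of_lt (enorm_le_iff_norm_le.2 ((K y).norm_coe_le_norm 1)) hyr))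
    simp only [Icc.coe_one, RCLike.ofReal_one, one_pow, one_smul, zero_add] at h1 h2
    exact h1.unique h2
  rw [hone]
  have := hKs 1
  rw [volterra_apply, Icc.coe_one] at this
  rw [hevγ, ← this]

/-- **Poincaré linearization.** An analytic vector field with linear part the Euler field at `0`
becomes the Euler field in suitable analytic coordinates `ψ` tangent to the identity. -/
theorem exists_linearization_of_fderiv_eq_id [CompleteSpace E] [NormedSpace ℝ E]
    [IsScalarTower ℝ 𝕜 E] {X : E → E}
    (hX : AnalyticAt 𝕜 X 0) (hX0 : X 0 = 0)
    (hX1 : fderiv 𝕜 X 0 = ContinuousLinearMap.id 𝕜 E) :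
    ∃ ψ : OpenPartialHomeomorph E E, 0 ∈ ψ.source ∧ ψ 0 = 0 ∧ AnalyticOnNhd 𝕜 ψ ψ.source ∧
      AnalyticOnNhd 𝕜 ψ.symm ψ.target ∧ fderiv 𝕜 ψ 0 = ContinuousLinearMap.id 𝕜 E ∧
      (∀ x ∈ ψ.source, fderiv 𝕜 ψ x (X x) = ψ x) ∧
      ∀ y ∈ ψ.target, fderiv 𝕜 ψ.symm y y = X (ψ.symm y) := by
  -- With `f = X - id` the equation reads `Dη(y) y = X (η y)`: `η` carries the Euler field to `X`,
  -- and `ψ` is its local inverse.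
  obtain ⟨η, hη, hη0, hη1, hηX⟩ := exists_analyticAt_fderiv_apply_self_eq (𝕜 := 𝕜)
    (f := fun x => X x - x) (hX.sub analyticAt_id) (by simp [hX0]) (by
      rw [fderiv_fun_sub hX.differentiableAt differentiableAt_fun_id, hX1, fderiv_fun_id, sub_self])
  have hηd : HasFDerivAt η
      ((ContinuousLinearEquiv.refl 𝕜 E : E ≃L[𝕜] E) : E →L[𝕜] E) 0 := by
    have := hη.differentiableAt.hasFDerivAt
    rw [hη1] at this
    exact this
  have hηc : ContDiffAt 𝕜 ω η 0 := hη.contDiffAt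
  set e := hηc.toOpenPartialHomeomorph η hηd (by simp) with he
  have he0 : (0 : E) ∈ e.source := hηc.mem_toOpenPartialHomeomorph_source hηd (by simp)
  have heη : ∀ y, e y = η y := fun _ => rfl
  have hes0 : e.symm 0 = 0 := by
    conv_lhs => rw [← hη0, ← heη]
    exact e.left_inv he0
  have het0 : (0 : E) ∈ e.target := by
    have := e.map_source he0
    rwa [heη, hη0] at this
  have hesa : AnalyticAt 𝕜 e.symm 0 :=
    e.analyticAt_symm (i := ContinuousLinearEquiv.refl 𝕜 E) het0
      (by rw [hes0]; exact hη) (by rw [hes0]; exact hηd.fderiv)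
  have hes1 : HasFDerivAt e.symm (ContinuousLinearMap.id 𝕜 E) 0 :=
    e.hasFDerivAt_symm (f' := ContinuousLinearEquiv.refl 𝕜 E) het0 (by rw [hes0]; exact hηd)
  have hgood : ∀ᶠ y in 𝓝 (0 : E), AnalyticAt 𝕜 η y ∧ AnalyticAt 𝕜 e.symm (η y) ∧
      fderiv 𝕜 η y y = X (η y) := by
    have h1 : ∀ᶠ y in 𝓝 (0 : E), AnalyticAt 𝕜 e.symm (η y) :=
      hη.continuousAt.eventually (by rw [hη0]; exact hesa.eventually_analyticAt)
    filter_upwards [hη.eventually_analyticAt, h1, hηX] with y h2 h3 h4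
    exact ⟨h2, h3, by rw [h4]; abel⟩
  obtain ⟨S, hS, hSo, hS0⟩ := eventually_nhds_iff.1 hgood
  have hmem : ∀ {y}, y ∈ (e.restrOpen S hSo).source ↔ y ∈ e.source ∧ y ∈ S := fun {y} => by
    rw [e.restrOpen_source]; rfl
  refine ⟨(e.restrOpen S hSo).symm, ?_, hes0, ?_, ?_, hes1.fderiv, ?_, ?_⟩
  · have := (e.restrOpen S hSo).map_source (hmem.2 ⟨he0, hS0⟩)
    have h : (e.restrOpen S hSo) 0 = 0 := hη0
    rwa [h] at this
  · intro x hx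
    have h1 := hmem.1 ((e.restrOpen S hSo).map_target hx)
    have h2 := (hS _ h1.2).2.1
    rw [show η ((e.restrOpen S hSo).symm x) = x from (e.restrOpen S hSo).right_inv hx] at h2
    exact h2
  · intro y hy
    exact (hS y (hmem.1 hy).2).1
  · intro x hx
    have hy := (e.restrOpen S hSo).map_target hx
    set y := (e.restrOpen S hSo).symm x with hyd
    have hxy : η y = x := (e.restrOpen S hSo).right_inv hx
    obtain ⟨h1, h2, h3⟩ := hS y (hmem.1 hy).2
    have hid : (fun z => e.symm (η z)) =ᶠ[𝓝 y] fun z => z := by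
      filter_upwards [e.open_source.mem_nhds (hmem.1 hy).1] with z hz using e.left_inv hz
    have hcomp : HasFDerivAt (fun z => e.symm (η z)) _ y :=
      h2.differentiableAt.hasFDerivAt.comp y h1.differentiableAt.hasFDerivAt
    have := hcomp.fderiv.symm.trans hid.fderiv_eq
    rw [fderiv_fun_id] at this
    have h5 := congrArg (fun L : E →L[𝕜] E => L y) this
    simp only [ContinuousLinearMap.comp_apply, h3, ContinuousLinearMap.id_apply, hxy] at h5
    exact h5
  · intro y hy
    exact (hS y (hmem.1 hy).2).2.2

/-- A differentiable function on a ball which is an eigenfunction, with eigenvalue `1`, of the Euler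
field is linear. -/
theorem eq_fderiv_zero_apply_of_fderiv_apply_self_eq [NormedSpace ℝ E] [IsScalarTower ℝ 𝕜 E]
    [NormedSpace ℝ F] [IsScalarTower ℝ 𝕜 F] {g : E → F} {ρ : ℝ}
    (hg : ∀ y ∈ Metric.ball (0 : E) ρ, DifferentiableAt 𝕜 g y)
    (hgy : ∀ y ∈ Metric.ball (0 : E) ρ, fderiv 𝕜 g y y = g y) {y : E}
    (hy : y ∈ Metric.ball (0 : E) ρ) : g y = fderiv 𝕜 g 0 y := by
  have h0 : (0 : E) ∈ Metric.ball (0 : E) ρ := Metric.mem_ball_self (Metric.pos_of_mem_ball hy)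
  have hg0 : g 0 = 0 := by rw [← hgy 0 h0, map_zero]
  have hmem : ∀ t ∈ Icc (0 : ℝ) 1, t • y ∈ Metric.ball (0 : E) ρ := by
    intro t ht
    rw [mem_ball_zero_iff] at hy ⊢
    rw [norm_smul, Real.norm_of_nonneg ht.1]
    exact (mul_le_of_le_one_left (norm_nonneg _) ht.2).trans_lt hy
  have hd : ∀ t ∈ Icc (0 : ℝ) 1, HasDerivAt (fun t : ℝ => g (t • y)) (fderiv 𝕜 g (t • y) y) t := by
    intro t ht
    have h1 := (hg _ (hmem t ht)).hasFDerivAt.restrictScalars ℝ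
    have h2 : HasDerivAt (fun t : ℝ => t • y) y t := by
      simpa using (hasDerivAt_id t).smul_const y
    exact h1.comp_hasDerivAt t h2
  -- The Euler equation makes `g(ty) / t` constant on `(0, 1]`; its limit at `0` is the derivative
  -- of `g` at `0` along `y`.
  have hd' : ∀ t ∈ Ioc (0 : ℝ) 1,
      HasDerivAt (fun t : ℝ => t⁻¹ • g (t • y)) 0 t := by
    intro t ht
    have h1 := (hasDerivAt_inv ht.1.ne').smul (hd t ⟨ht.1.le, ht.2⟩)
    convert! h1 using 1
    have h2 := hgy _ (hmem t ⟨ht.1.le, ht.2⟩)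
    rw [RCLike.real_smul_eq_coe_smul (K := 𝕜) t y, map_smul,
      ← RCLike.real_smul_eq_coe_smul (K := 𝕜), ← RCLike.real_smul_eq_coe_smul (K := 𝕜)] at h2
    rw [← h2, smul_smul, ← add_smul]
    have : t⁻¹ + -(t ^ 2)⁻¹ * t = 0 := by have := ht.1.ne'; field_simp; ring
    rw [this, zero_smul]
  have hconst : ∀ t ∈ Ioc (0 : ℝ) 1, t⁻¹ • g (t • y) = g y := by
    intro t ht
    have h1 : ∀ x ∈ Icc t 1, x ∈ Ioc (0 : ℝ) 1 := fun x hx => ⟨ht.1.trans_le hx.1, hx.2⟩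
    have := constant_of_has_deriv_right_zero (f := fun t : ℝ => t⁻¹ • g (t • y)) (a := t) (b := 1)
      (fun x hx => (hd' x (h1 x hx)).continuousAt.continuousWithinAt)
      (fun x hx => (hd' x (h1 x ⟨hx.1, hx.2.le⟩)).hasDerivWithinAt) 1 ⟨ht.2, le_rfl⟩
    simpa using this.symm
  have hlim : Tendsto (fun t : ℝ => t⁻¹ • g (t • y)) (𝓝[>] 0) (𝓝 (fderiv 𝕜 g 0 y)) := by
    have h1 := hd 0 ⟨le_rfl, zero_le_one⟩
    rw [zero_smul] at h1
    have h2 := h1.tendsto_slope_zero_right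
    simpa [hg0] using h2
  refine tendsto_nhds_unique (tendsto_const_nhds.congr' ?_) hlim
  filter_upwards [Ioc_mem_nhdsGT (zero_lt_one' ℝ)] with t ht using (hconst t ht).symm

/-- In coordinates `ψ` which turn the vector field `X` into the Euler field, every eigenfunction of
`X` with eigenvalue `1` is linear. -/
theorem eq_fderiv_zero_comp_of_fderiv_apply_eq [NormedSpace ℝ E] [IsScalarTower ℝ 𝕜 E]
    [NormedSpace ℝ F] [IsScalarTower ℝ 𝕜 F] {X : E → E} {ψ : OpenPartialHomeomorph E E}
    (h0 : 0 ∈ ψ.source) (hψ0 : ψ 0 = 0) (hψs : AnalyticOnNhd 𝕜 ψ.symm ψ.target)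
    (hψ1 : fderiv 𝕜 ψ 0 = ContinuousLinearMap.id 𝕜 E)
    (hψ : AnalyticOnNhd 𝕜 ψ ψ.source)
    (hX : ∀ y ∈ ψ.target, fderiv 𝕜 ψ.symm y y = X (ψ.symm y))
    {ρ : ℝ} (hρ : Metric.ball 0 ρ ⊆ ψ.target) {f : E → F}
    (hf : ∀ x ∈ ψ.source, ψ x ∈ Metric.ball 0 ρ → DifferentiableAt 𝕜 f x)
    (hfX : ∀ x ∈ ψ.source, ψ x ∈ Metric.ball 0 ρ → fderiv 𝕜 f x (X x) = f x)
    {x : E} (hx : x ∈ ψ.source) (hxρ : ψ x ∈ Metric.ball 0 ρ) : f x = fderiv 𝕜 f 0 (ψ x) := by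
  have hchain : ∀ y ∈ Metric.ball (0 : E) ρ, HasFDerivAt (fun y => f (ψ.symm y))
      ((fderiv 𝕜 f (ψ.symm y)).comp (fderiv 𝕜 ψ.symm y)) y := by
    intro y hy
    have h1 := hf (ψ.symm y) (ψ.map_target (hρ hy)) (by rwa [ψ.right_inv (hρ hy)])
    exact h1.hasFDerivAt.comp y (hψs y (hρ hy)).differentiableAt.hasFDerivAt
  have key := eq_fderiv_zero_apply_of_fderiv_apply_self_eq (𝕜 := 𝕜)
    (g := fun y => f (ψ.symm y)) (fun y hy => (hchain y hy).differentiableAt) (fun y hy => by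
      rw [(hchain y hy).fderiv, ContinuousLinearMap.comp_apply, hX y (hρ hy)]
      exact hfX _ (ψ.map_target (hρ hy)) (by rwa [ψ.right_inv (hρ hy)])) hxρ
  have h0ρ : (0 : E) ∈ Metric.ball (0 : E) ρ := Metric.mem_ball_self (Metric.pos_of_mem_ball hxρ)
  have hs0 : ψ.symm 0 = 0 := by
    conv_lhs => rw [← hψ0]
    exact ψ.left_inv h0
  have hs1 : fderiv 𝕜 ψ.symm 0 = ContinuousLinearMap.id 𝕜 E := by
    have h1 : HasFDerivAt (fun z => ψ.symm (ψ z)) _ 0 := HasFDerivAt.comp (g := ψ.symm) (0 : E)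
      (by rw [hψ0]; exact (hψs 0 (hρ h0ρ)).differentiableAt.hasFDerivAt)
      (hψ 0 h0).differentiableAt.hasFDerivAt
    have h2 : (fun z => ψ.symm (ψ z)) =ᶠ[𝓝 0] fun z => z := by
      filter_upwards [ψ.open_source.mem_nhds h0] with z hz using ψ.left_inv hz
    have := h1.fderiv.symm.trans h2.fderiv_eq
    rwa [fderiv_fun_id, hψ1, ContinuousLinearMap.comp_id] at this
  rw [(hchain 0 h0ρ).fderiv, hs1, hs0, ContinuousLinearMap.comp_id] at key
  simpa only [ψ.left_inv hx] using key

end Linearization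

/-! ### The Liouville identity and its consequences for bivector components. -/

section PoissonVectorFields

set_option maxSynthPendingDepth 3

open Filter Topology

variable {𝕜 : Type*} [RCLike 𝕜]
  {E : Type*} [NormedAddCommGroup E] [NormedSpace 𝕜 E]

/-- If `DΨ X = Ψ` near `x`, then `D²Ψ(X, ·) = DΨ ∘ (1 - DX)` at `x`. -/
theorem fderiv_fderiv_apply_of_fderiv_apply_eq [CompleteSpace E] {Ψ X : E → E} {x : E}
    (hΨ : AnalyticAt 𝕜 Ψ x)
    (hX : DifferentiableAt 𝕜 X x) (h : ∀ᶠ z in 𝓝 x, fderiv 𝕜 Ψ z (X z) = Ψ z) :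
    fderiv 𝕜 (fderiv 𝕜 Ψ) x (X x) =
      (fderiv 𝕜 Ψ x).comp (ContinuousLinearMap.id 𝕜 E - fderiv 𝕜 X x) := by
  have h1 : HasFDerivAt (fun z => fderiv 𝕜 Ψ z (X z)) _ x :=
    hΨ.fderiv.differentiableAt.hasFDerivAt.clm_apply hX.hasFDerivAt
  -- Differentiating `DΨ X = Ψ` along `u` gives `D²Ψ(u, X) + DΨ (DX u) = DΨ u`; symmetry of `D²Ψ`
  -- then exchanges `u` and `X`.
  have h2 := h1.fderiv.symm.trans (EventuallyEq.fderiv_eq h)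
  have hsymm : IsSymmSndFDerivAt 𝕜 Ψ x := (hΨ.contDiffAt (n := ω)).isSymmSndFDerivAt_of_omega
  ext u
  have h3 := congrArg (fun L : E →L[𝕜] E => L u) h2
  simp only [add_apply, ContinuousLinearMap.comp_apply,
    ContinuousLinearMap.flip_apply] at h3
  rw [hsymm.eq, ContinuousLinearMap.comp_apply, sub_apply, map_sub,
    ContinuousLinearMap.id_apply, ← h3, hsymm.eq]
  abel

/-- The derivative, along an analytic map `Ψ`, of the pushed-forward linear bivector field. -/
theorem hasFDerivAt_bivector_comp_fderiv [CompleteSpace E]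
    (β : E →L[𝕜] (E →L[𝕜] 𝕜) →L[𝕜] (E →L[𝕜] 𝕜) →L[𝕜] 𝕜) {Ψ : E → E} {x : E}
    (hΨ : AnalyticAt 𝕜 Ψ x) (α α' : E →L[𝕜] 𝕜) :
    ∃ L : E →L[𝕜] 𝕜, HasFDerivAt
      (fun z => β z (α.comp (fderiv 𝕜 Ψ z)) (α'.comp (fderiv 𝕜 Ψ z))) L x ∧
      ∀ u, L u = β u (α.comp (fderiv 𝕜 Ψ x)) (α'.comp (fderiv 𝕜 Ψ x)) +
        β x (α.comp (fderiv 𝕜 (fderiv 𝕜 Ψ) x u)) (α'.comp (fderiv 𝕜 Ψ x)) +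
        β x (α.comp (fderiv 𝕜 Ψ x)) (α'.comp (fderiv 𝕜 (fderiv 𝕜 Ψ) x u)) := by
  have hD := hΨ.fderiv.differentiableAt.hasFDerivAt
  have hα : ∀ γ : E →L[𝕜] 𝕜, HasFDerivAt (fun z => γ.comp (fderiv 𝕜 Ψ z))
      ((ContinuousLinearMap.compL 𝕜 E E 𝕜 γ).comp (fderiv 𝕜 (fderiv 𝕜 Ψ) x)) x := fun γ =>
    (ContinuousLinearMap.compL 𝕜 E E 𝕜 γ).hasFDerivAt.comp x hD
  have h := (β.hasFDerivAt (x := x)).clm_apply (hα α) |>.clm_apply (hα α')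
  refine ⟨_, h, fun u => ?_⟩
  simp only [add_apply, ContinuousLinearMap.comp_apply,
    ContinuousLinearMap.flip_apply, ContinuousLinearMap.compL_apply]
  abel

/-- The pullback, by a Poisson diffeomorphism `Φ`, of the Euler field rescales a linear Poisson
structure as the Euler field does. -/
theorem liouville_of_fderiv_apply_eq [CompleteSpace E]
    (β : E →L[𝕜] (E →L[𝕜] 𝕜) →L[𝕜] (E →L[𝕜] 𝕜) →L[𝕜] 𝕜) {Φ X : E → E} {x : E}
    (hΦ : AnalyticAt 𝕜 Φ x) (hX : DifferentiableAt 𝕜 X x)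
    (h : ∀ᶠ z in 𝓝 x, fderiv 𝕜 Φ z (X z) = Φ z)
    (hP : ∀ᶠ z in 𝓝 x, ∀ α α' : E →L[𝕜] 𝕜,
      β z (α.comp (fderiv 𝕜 Φ z)) (α'.comp (fderiv 𝕜 Φ z)) = β (Φ z) α α')
    {B : E →L[𝕜] E} (hB : B.comp (fderiv 𝕜 Φ x) = ContinuousLinearMap.id 𝕜 E)
    (a a' : E →L[𝕜] 𝕜) :
    β (X x) a a' + β x a a' =
      β x (a.comp (fderiv 𝕜 X x)) a' + β x a (a'.comp (fderiv 𝕜 X x)) := by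
  have hab : ∀ γ : E →L[𝕜] 𝕜, (γ.comp B).comp (fderiv 𝕜 Φ x) = γ := fun γ => by
    rw [ContinuousLinearMap.comp_assoc, hB, ContinuousLinearMap.comp_id]
  -- The Poisson identity is differentiated along `X`. The covectors `a ∘ B`, `a' ∘ B` are chosen so
  -- that their pullbacks at `x` are `a`, `a'`.
  obtain ⟨L, hL, hLu⟩ := hasFDerivAt_bivector_comp_fderiv β hΦ (a.comp B) (a'.comp B)
  have h1 : HasFDerivAt (fun z => β (Φ z) (a.comp B) (a'.comp B))
      (((β.flip (a.comp B)).flip (a'.comp B)).comp (fderiv 𝕜 Φ x)) x :=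
    ((β.flip (a.comp B)).flip (a'.comp B)).hasFDerivAt.comp x hΦ.differentiableAt.hasFDerivAt
  have h2 : L = _ := hL.fderiv.symm.trans
    ((EventuallyEq.fderiv_eq (hP.mono fun z hz => hz (a.comp B) (a'.comp B))).trans h1.fderiv)
  have h3 := hLu (X x)
  rw [h2, fderiv_fderiv_apply_of_fderiv_apply_eq hΦ hX h] at h3
  simp only [ContinuousLinearMap.comp_apply, ContinuousLinearMap.flip_apply, h.self_of_nhds] at h3
  rw [← hP.self_of_nhds, ← ContinuousLinearMap.comp_assoc, ← ContinuousLinearMap.comp_assoc, hab,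
    hab, ContinuousLinearMap.comp_sub, ContinuousLinearMap.comp_sub, ContinuousLinearMap.comp_id,
    ContinuousLinearMap.comp_id] at h3
  simp only [map_sub, sub_apply] at h3
  linear_combination -h3

/-- If `X` rescales `β` as the Euler field does and `DΨ X = Ψ`, the components of the push-forward
of `β` by `Ψ` are eigenfunctions of `X`. -/
theorem fderiv_bivector_comp_fderiv_apply_eq [CompleteSpace E]
    (β : E →L[𝕜] (E →L[𝕜] 𝕜) →L[𝕜] (E →L[𝕜] 𝕜) →L[𝕜] 𝕜) {Ψ X : E → E} {x : E}
    (hΨ : AnalyticAt 𝕜 Ψ x) (hX : DifferentiableAt 𝕜 X x)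
    (h : ∀ᶠ z in 𝓝 x, fderiv 𝕜 Ψ z (X z) = Ψ z)
    (hβ : ∀ a a' : E →L[𝕜] 𝕜, β (X x) a a' + β x a a' =
      β x (a.comp (fderiv 𝕜 X x)) a' + β x a (a'.comp (fderiv 𝕜 X x)))
    (α α' : E →L[𝕜] 𝕜) :
    fderiv 𝕜 (fun z => β z (α.comp (fderiv 𝕜 Ψ z)) (α'.comp (fderiv 𝕜 Ψ z))) x (X x) =
      β x (α.comp (fderiv 𝕜 Ψ x)) (α'.comp (fderiv 𝕜 Ψ x)) := by
  obtain ⟨L, hL, hLu⟩ := hasFDerivAt_bivector_comp_fderiv β hΨ α α'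
  have h1 := hβ (α.comp (fderiv 𝕜 Ψ x)) (α'.comp (fderiv 𝕜 Ψ x))
  rw [hL.fderiv, hLu, fderiv_fderiv_apply_of_fderiv_apply_eq hΨ hX h,
    ← ContinuousLinearMap.comp_assoc, ← ContinuousLinearMap.comp_assoc,
    ContinuousLinearMap.comp_sub, ContinuousLinearMap.comp_sub, ContinuousLinearMap.comp_id,
    ContinuousLinearMap.comp_id]
  simp only [map_sub, sub_apply]
  linear_combination h1

end PoissonVectorFields

/-! ### Invariant integration over a compact group. -/

section Averaging

open Filter Topology MeasureTheory

/-- A compact group carries a right-invariant Borel probability measure. -/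
theorem exists_isMulRightInvariant_isProbabilityMeasure (G : Type*) [Group G] [TopologicalSpace G]
    [IsTopologicalGroup G] [CompactSpace G] [T2Space G] [MeasurableSpace G] [BorelSpace G] :
    ∃ μ : Measure G, μ.IsMulRightInvariant ∧ IsProbabilityMeasure μ := by
  let ν : Measure G := Measure.haarMeasure ⊤
  have hν : ν Set.univ = 1 :=
    Measure.haarMeasure_self (K₀ := (⊤ : TopologicalSpace.PositiveCompacts G))
  -- Haar measure is left invariant; inversion makes it right invariant.
  refine ⟨ν.inv, inferInstance, ⟨?_⟩⟩
  rw [Measure.inv_apply, Set.inv_univ, hν]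

variable {𝕜 : Type*} [RCLike 𝕜]
  {F : Type*} [NormedAddCommGroup F] [NormedSpace 𝕜 F] [NormedSpace ℝ F] [IsScalarTower ℝ 𝕜 F]
  {G : Type*} [TopologicalSpace G] [CompactSpace G] [MeasurableSpace G] [BorelSpace G]

theorem Continuous.integrable_of_compactSpace {F : Type*} [NormedAddCommGroup F] {f : G → F}
    (hf : Continuous f) (μ : Measure G) [IsFiniteMeasure μ] : Integrable f μ :=
  hf.integrable_of_hasCompactSupport (HasCompactSupport.of_compactSpace f)

/-- Integration against a probability measure, as a continuous linear map on the space of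
continuous functions on a compact space. -/
noncomputable def integralContinuousMapCLM (𝕜 : Type*) [RCLike 𝕜] (F : Type*)
    [NormedAddCommGroup F] [NormedSpace 𝕜 F] [NormedSpace ℝ F] [IsScalarTower ℝ 𝕜 F]
    (μ : Measure G) [IsProbabilityMeasure μ] : C(G, F) →L[𝕜] F :=
  LinearMap.mkContinuous
    { toFun := fun f => ∫ g, f g ∂μ
      map_add' := fun f f' => integral_add (f.continuous.integrable_of_compactSpace μ)
        (f'.continuous.integrable_of_compactSpace μ)
      map_smul' := fun c f => integral_smul c _ }
    1 (fun f => by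
      have := norm_integral_le_of_norm_le_const (μ := μ) (f := f)
        (Eventually.of_forall f.norm_coe_le_norm)
      simpa using this)

theorem integralContinuousMapCLM_apply (μ : Measure G) [IsProbabilityMeasure μ] (f : C(G, F)) :
    integralContinuousMapCLM 𝕜 F μ f = ∫ g, f g ∂μ := rfl

end Averaging

/-! ### Pullbacks of the Euler field and their average. -/

section AveragedField

set_option maxSynthPendingDepth 3

open Filter Topology MeasureTheory

/-- An action of a group on an open neighbourhood `W` of `0`, by analytic maps fixing `0`. -/
structure IsAnalyticActionFixingZero (𝕜 : Type*) [RCLike 𝕜] {E : Type*} [NormedAddCommGroup E]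
    [NormedSpace 𝕜 E] {G : Type*} [Group G] (W : Set E) (Φ : G → E → E) : Prop where
  isOpen : IsOpen W
  zero_mem : 0 ∈ W
  mapsTo : ∀ g, Set.MapsTo (Φ g) W W
  one : ∀ x ∈ W, Φ 1 x = x
  mul : ∀ g h, ∀ x ∈ W, Φ (g * h) x = Φ g (Φ h x)
  analytic : ∀ g, AnalyticOnNhd 𝕜 (Φ g) W
  map_zero : ∀ g, Φ g 0 = 0

/-- The pullback of the Euler field by the action of `h`. -/
noncomputable def eulerPullback (𝕜 : Type*) [RCLike 𝕜] {E : Type*} [NormedAddCommGroup E]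
    [NormedSpace 𝕜 E] {G : Type*} [Group G] (Φ : G → E → E) (h : G) (x : E) : E :=
  fderiv 𝕜 (Φ h⁻¹) (Φ h x) (Φ h x)

/-- `Φ` is jointly real analytic at `(g₀, 0)` for all `g₀`: it factors locally through a continuous
map to a normed space and a real analytic function. -/
def IsJointlyAnalyticAtZero (V : Type*) [NormedAddCommGroup V] [NormedSpace ℝ V] {E F : Type*}
    [NormedAddCommGroup E] [NormedSpace ℝ E] [NormedAddCommGroup F] [NormedSpace ℝ F]
    {G : Type*} [TopologicalSpace G] (Y : G → E → F) : Prop :=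
  ∀ g₀, ∃ κ : G → V, ContinuousAt κ g₀ ∧ ∃ f : V × E → F, AnalyticAt ℝ f (κ g₀, 0) ∧
    ∀ᶠ p in 𝓝 (g₀, (0 : E)), Y p.1 p.2 = f (κ p.1, p.2)

variable {𝕜 : Type*} [RCLike 𝕜] {E : Type*} [NormedAddCommGroup E] [NormedSpace 𝕜 E]
  {G : Type*} [Group G] {W : Set E} {Φ : G → E → E}

namespace IsAnalyticActionFixingZero

theorem fderiv_mul (hΦ : IsAnalyticActionFixingZero 𝕜 W Φ) (g h : G) {x : E} (hx : x ∈ W) :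
    fderiv 𝕜 (Φ (g * h)) x = (fderiv 𝕜 (Φ g) (Φ h x)).comp (fderiv 𝕜 (Φ h) x) := by
  have h1 : HasFDerivAt (fun z => Φ g (Φ h z)) _ x :=
    (hΦ.analytic g _ (hΦ.mapsTo h hx)).differentiableAt.hasFDerivAt.comp x
      (hΦ.analytic h x hx).differentiableAt.hasFDerivAt
  rw [← h1.fderiv]
  refine EventuallyEq.fderiv_eq ?_
  filter_upwards [hΦ.isOpen.mem_nhds hx] with z hz using hΦ.mul g h z hz

theorem fderiv_one (hΦ : IsAnalyticActionFixingZero 𝕜 W Φ) {x : E} (hx : x ∈ W) :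
    fderiv 𝕜 (Φ 1) x = ContinuousLinearMap.id 𝕜 E := by
  rw [← fderiv_fun_id (𝕜 := 𝕜) (x := x)]
  refine EventuallyEq.fderiv_eq ?_
  filter_upwards [hΦ.isOpen.mem_nhds hx] with z hz using hΦ.one z hz

theorem inv_apply (hΦ : IsAnalyticActionFixingZero 𝕜 W Φ) (h : G) {x : E} (hx : x ∈ W) :
    Φ h⁻¹ (Φ h x) = x := by
  rw [← hΦ.mul _ _ _ hx, inv_mul_cancel, hΦ.one x hx]

theorem fderiv_inv_comp (hΦ : IsAnalyticActionFixingZero 𝕜 W Φ) (h : G) {x : E} (hx : x ∈ W) :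
    (fderiv 𝕜 (Φ h⁻¹) (Φ h x)).comp (fderiv 𝕜 (Φ h) x) = ContinuousLinearMap.id 𝕜 E := by
  rw [← hΦ.fderiv_mul _ _ hx, inv_mul_cancel, hΦ.fderiv_one hx]

theorem fderiv_comp_inv (hΦ : IsAnalyticActionFixingZero 𝕜 W Φ) (g h : G) {x : E} (hx : x ∈ W) :
    (fderiv 𝕜 (Φ g) x).comp (fderiv 𝕜 (Φ h⁻¹) (Φ h x)) = fderiv 𝕜 (Φ (g * h⁻¹)) (Φ h x) := by
  rw [hΦ.fderiv_mul _ _ (hΦ.mapsTo h hx), hΦ.inv_apply h hx]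

theorem fderiv_apply_eulerPullback (hΦ : IsAnalyticActionFixingZero 𝕜 W Φ) (h : G) {x : E}
    (hx : x ∈ W) : fderiv 𝕜 (Φ h) x (eulerPullback 𝕜 Φ h x) = Φ h x := by
  have := congrArg (fun L : E →L[𝕜] E => L (Φ h x)) (hΦ.fderiv_comp_inv h h hx)
  rwa [mul_inv_cancel, hΦ.fderiv_one (hΦ.mapsTo h hx)] at this

/-- Pushing forward by `Φ g` only translates the index on the right, which is why the average uses a
right-invariant measure. -/
theorem fderiv_apply_eulerPullback_mul (hΦ : IsAnalyticActionFixingZero 𝕜 W Φ) (g h : G) {x : E}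
    (hx : x ∈ W) :
    fderiv 𝕜 (Φ g) x (eulerPullback 𝕜 Φ (h * g) x) = eulerPullback 𝕜 Φ h (Φ g x) := by
  have := congrArg (fun L : E →L[𝕜] E => L (Φ (h * g) x)) (hΦ.fderiv_comp_inv g (h * g) hx)
  rw [show g * (h * g)⁻¹ = h⁻¹ by group, hΦ.mul h g x hx] at this
  rw [eulerPullback, eulerPullback, hΦ.mul h g x hx]
  exact this

theorem analyticOnNhd_eulerPullback [CompleteSpace E] (hΦ : IsAnalyticActionFixingZero 𝕜 W Φ)
    (h : G) : AnalyticOnNhd 𝕜 (eulerPullback 𝕜 Φ h) W := by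
  intro x hx
  have h1 := hΦ.analytic h x hx
  have h2 : AnalyticAt 𝕜 (fun z => fderiv 𝕜 (Φ h⁻¹) (Φ h z)) x :=
    (hΦ.analytic h⁻¹ _ (hΦ.mapsTo h hx)).fderiv.comp h1
  exact ((ContinuousLinearMap.id 𝕜 (E →L[𝕜] E)).analyticAt_bilinear _).comp (h2.prod h1)

theorem eulerPullback_zero (hΦ : IsAnalyticActionFixingZero 𝕜 W Φ) (h : G) :
    eulerPullback 𝕜 Φ h 0 = 0 := by
  rw [eulerPullback, hΦ.map_zero, _root_.map_zero]

theorem eventually_fderiv_apply_eulerPullback (hΦ : IsAnalyticActionFixingZero 𝕜 W Φ) (h : G)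
    {x : E} (hx : x ∈ W) : ∀ᶠ z in 𝓝 x, fderiv 𝕜 (Φ h) z (eulerPullback 𝕜 Φ h z) = Φ h z := by
  filter_upwards [hΦ.isOpen.mem_nhds hx] with z hz using hΦ.fderiv_apply_eulerPullback h hz

/-- The pullback field vanishes at `0`, so the second-derivative identity reduces there to `DΦ ∘ (1
- DX) = 0`, and `DΦ` is left invertible. -/
theorem fderiv_eulerPullback_zero [CompleteSpace E] (hΦ : IsAnalyticActionFixingZero 𝕜 W Φ)
    (h : G) : fderiv 𝕜 (eulerPullback 𝕜 Φ h) 0 = ContinuousLinearMap.id 𝕜 E := by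
  have h1 := fderiv_fderiv_apply_of_fderiv_apply_eq (hΦ.analytic h 0 hΦ.zero_mem)
    (hΦ.analyticOnNhd_eulerPullback h 0 hΦ.zero_mem).differentiableAt
    (hΦ.eventually_fderiv_apply_eulerPullback h hΦ.zero_mem)
  rw [hΦ.eulerPullback_zero, _root_.map_zero] at h1
  have h2 := congrArg (fun L => (fderiv 𝕜 (Φ h⁻¹) (Φ h 0)).comp L) h1
  simp only [← ContinuousLinearMap.comp_assoc, hΦ.fderiv_inv_comp h hΦ.zero_mem,
    ContinuousLinearMap.comp_zero, ContinuousLinearMap.id_comp] at h2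
  exact (sub_eq_zero.1 h2.symm).symm

theorem liouville_eulerPullback [CompleteSpace E] (hΦ : IsAnalyticActionFixingZero 𝕜 W Φ)
    (β : E →L[𝕜] (E →L[𝕜] 𝕜) →L[𝕜] (E →L[𝕜] 𝕜) →L[𝕜] 𝕜) (h : G)
    (hP : ∀ x ∈ W, ∀ α α' : E →L[𝕜] 𝕜,
      β x (α.comp (fderiv 𝕜 (Φ h) x)) (α'.comp (fderiv 𝕜 (Φ h) x)) = β (Φ h x) α α')
    {x : E} (hx : x ∈ W) (a a' : E →L[𝕜] 𝕜) :
    β (eulerPullback 𝕜 Φ h x) a a' + β x a a' =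
      β x (a.comp (fderiv 𝕜 (eulerPullback 𝕜 Φ h) x)) a' +
        β x a (a'.comp (fderiv 𝕜 (eulerPullback 𝕜 Φ h) x)) :=
  liouville_of_fderiv_apply_eq β (hΦ.analytic h x hx)
    (hΦ.analyticOnNhd_eulerPullback h x hx).differentiableAt
    (hΦ.eventually_fderiv_apply_eulerPullback h hx)
    (by filter_upwards [hΦ.isOpen.mem_nhds hx] with z hz using hP z hz)
    (hΦ.fderiv_inv_comp h hx) a a'

/-- The field is `(DΦ h)⁻¹` applied to `Φ h`. Inverting the partial derivative as an operator keeps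
everything in the chart at `g₀`, with no need for a chart at `g₀⁻¹`. -/
theorem isJointlyAnalyticAtZero_eulerPullback [CompleteSpace E] [NormedSpace ℝ E]
    [IsScalarTower ℝ 𝕜 E] {V : Type*} [NormedAddCommGroup V] [NormedSpace ℝ V]
    [TopologicalSpace G] (hΦ : IsAnalyticActionFixingZero 𝕜 W Φ)
    (hJ : IsJointlyAnalyticAtZero V Φ) :
    IsJointlyAnalyticAtZero V (eulerPullback 𝕜 Φ) := by
  intro g₀
  obtain ⟨κ, hκ, f, hf, hfΦ⟩ := hJ g₀
  set A : V × E → E →L[ℝ] E := fun p =>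
    (fderiv ℝ f p).comp (ContinuousLinearMap.inr ℝ V E) with hA
  have hc : ContinuousAt (fun p : G × E => (κ p.1, p.2)) (g₀, 0) :=
    (hκ.comp (f := Prod.fst) (x := (g₀, (0 : E))) continuousAt_fst).prodMk continuousAt_snd
  have hev : ∀ᶠ p in 𝓝 (g₀, (0 : E)), IsUnit (A (κ p.1, p.2)) ∧
      A (κ p.1, p.2) (eulerPullback 𝕜 Φ p.1 p.2) = f (κ p.1, p.2) := by
    have h1 : ∀ᶠ p in 𝓝 (g₀, (0 : E)), AnalyticAt ℝ f (κ p.1, p.2) :=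
      hc.eventually hf.eventually_analyticAt
    have h2 : ∀ᶠ p in 𝓝 (g₀, (0 : E)), p.2 ∈ W :=
      continuousAt_snd.eventually (hΦ.isOpen.mem_nhds hΦ.zero_mem)
    filter_upwards [h1, h2, hfΦ.eventually_nhds] with p hp1 hp2 hp3
    obtain ⟨g, x⟩ := p
    have hp4 : ∀ᶠ z in 𝓝 x, Φ g z = f (κ g, z) :=
      (Continuous.prodMk_right g).continuousAt.eventually hp3
    have hder : HasFDerivAt (fun z => f (κ g, z)) (A (κ g, x)) x :=
      hp1.differentiableAt.hasFDerivAt.comp x (hasFDerivAt_prodMk_right (κ g) x)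
    have hder' : HasFDerivAt (Φ g) ((fderiv 𝕜 (Φ g) x).restrictScalars ℝ) x :=
      (hΦ.analytic g x hp2).differentiableAt.hasFDerivAt.restrictScalars ℝ
    have hAe : A (κ g, x) = (fderiv 𝕜 (Φ g) x).restrictScalars ℝ :=
      hder.unique (hder'.congr_of_eventuallyEq (hp4.mono fun _ h => h.symm))
    have hl := hΦ.fderiv_inv_comp g hp2
    have hr := hΦ.fderiv_comp_inv g g hp2
    rw [mul_inv_cancel, hΦ.fderiv_one (hΦ.mapsTo g hp2)] at hr
    refine ⟨⟨⟨A (κ g, x), (fderiv 𝕜 (Φ g⁻¹) (Φ g x)).restrictScalars ℝ, ?_, ?_⟩, rfl⟩, ?_⟩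
    · rw [hAe]
      ext u
      exact congrArg (fun L : E →L[𝕜] E => L u) hr
    · rw [hAe]
      ext u
      exact congrArg (fun L : E →L[𝕜] E => L u) hl
    · rw [hAe, ← hp4.self_of_nhds]
      exact hΦ.fderiv_apply_eulerPullback g hp2
  refine ⟨κ, hκ, fun p => Ring.inverse (A p) (f p), ?_, ?_⟩
  · have hAa : AnalyticAt ℝ A (κ g₀, 0) :=
      ((ContinuousLinearMap.compL ℝ E (V × E) E).flip
        (ContinuousLinearMap.inr ℝ V E)).analyticAt _ |>.comp hf.fderiv
    obtain ⟨u, hu⟩ := hev.self_of_nhds.1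
    have hinv : AnalyticAt ℝ (fun p => Ring.inverse (A p)) (κ g₀, 0) := by
      refine AnalyticAt.comp (g := Ring.inverse) ?_ hAa
      rw [← hu]
      exact analyticAt_inverse u
    exact ((ContinuousLinearMap.id ℝ (E →L[ℝ] E)).analyticAt_bilinear _).comp (hinv.prod hf)
  · filter_upwards [hev] with p hp
    rw [← hp.2, ← mul_apply_eq_comp, Ring.inverse_mul_cancel _ hp.1,
      one_apply_eq_self]

end IsAnalyticActionFixingZero

/-- The average over a compact group of the pullbacks of the Euler field. It is invariant, and
rescales every invariant linear Poisson structure as the Euler field does. -/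
theorem exists_invariant_field [NormedSpace ℝ E] [IsScalarTower ℝ 𝕜 E] [FiniteDimensional 𝕜 E]
    [TopologicalSpace G] [IsTopologicalGroup G] [CompactSpace G] [T2Space G]
    {V : Type*} [NormedAddCommGroup V] [NormedSpace ℝ V]
    (hΦ : IsAnalyticActionFixingZero 𝕜 W Φ) (hJ : IsJointlyAnalyticAtZero V Φ)
    (β : E →L[𝕜] (E →L[𝕜] 𝕜) →L[𝕜] (E →L[𝕜] 𝕜) →L[𝕜] 𝕜)
    (hP : ∀ h, ∀ x ∈ W, ∀ α α' : E →L[𝕜] 𝕜,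
      β x (α.comp (fderiv 𝕜 (Φ h) x)) (α'.comp (fderiv 𝕜 (Φ h) x)) = β (Φ h x) α α') :
    ∃ X : E → E, AnalyticAt 𝕜 X 0 ∧ X 0 = 0 ∧ fderiv 𝕜 X 0 = ContinuousLinearMap.id 𝕜 E ∧
      (∃ O ∈ 𝓝 (0 : E), ∀ x ∈ O, ∀ g, Φ g x ∈ O → fderiv 𝕜 (Φ g) x (X x) = X (Φ g x)) ∧
      ∀ᶠ x in 𝓝 0, ∀ a a' : E →L[𝕜] 𝕜, β (X x) a a' + β x a a' =
        β x (a.comp (fderiv 𝕜 X x)) a' + β x a (a'.comp (fderiv 𝕜 X x)) := by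
  let _ : MeasurableSpace G := borel G
  have : BorelSpace G := ⟨rfl⟩
  have : CompleteSpace E := FiniteDimensional.complete 𝕜 E
  obtain ⟨μ, hμ, hμ1⟩ := exists_isMulRightInvariant_isProbabilityMeasure G
  obtain ⟨Ξ, hΞ, hΞY⟩ := exists_analyticAt_continuousMap (𝕜 := 𝕜) (eulerPullback 𝕜 Φ)
    (fun g => hΦ.analyticOnNhd_eulerPullback g 0 hΦ.zero_mem)
    (hΦ.isJointlyAnalyticAtZero_eulerPullback hJ)
  set J := integralContinuousMapCLM (G := G) 𝕜 E μ with hJdef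
  have hder : ∀ᶠ x in 𝓝 (0 : E), x ∈ W ∧ (∀ g, Ξ x g = eulerPullback 𝕜 Φ g x) ∧
      HasFDerivAt (fun x => J (Ξ x)) (J.comp (fderiv 𝕜 Ξ x)) x ∧
      ∀ u g, fderiv 𝕜 Ξ x u g = fderiv 𝕜 (eulerPullback 𝕜 Φ g) x u := by
    filter_upwards [hΞ.eventually_analyticAt, hΞY.eventually_nhds,
      hΦ.isOpen.mem_nhds hΦ.zero_mem] with x h1 h2 h3
    refine ⟨h3, h2.self_of_nhds, J.hasFDerivAt.comp x h1.differentiableAt.hasFDerivAt,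
      fun u g => ?_⟩
    have h4 : HasFDerivAt (fun z => Ξ z g) ((ContinuousMap.evalCLM 𝕜 g).comp (fderiv 𝕜 Ξ x)) x :=
      (ContinuousMap.evalCLM 𝕜 g : C(G, E) →L[𝕜] E).hasFDerivAt.comp x
        h1.differentiableAt.hasFDerivAt
    have h5 : (fun z => Ξ z g) =ᶠ[𝓝 x] eulerPullback 𝕜 Φ g := h2.mono fun z hz => hz g
    rw [← h5.fderiv_eq, h4.fderiv]
    rfl
  have hX0 : ∀ᶠ x in 𝓝 (0 : E), J (Ξ x) = ∫ g, eulerPullback 𝕜 Φ g x ∂μ := by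
    filter_upwards [hΞY] with x hx
    rw [hJdef, integralContinuousMapCLM_apply]
    simp_rw [hx]
  refine ⟨fun x => J (Ξ x), (J.analyticAt _).comp hΞ, ?_, ?_, ?_, ?_⟩
  · change J (Ξ 0) = 0
    rw [hX0.self_of_nhds]
    simp [hΦ.eulerPullback_zero]
  · obtain ⟨-, -, h1, h2⟩ := hder.self_of_nhds
    rw [h1.fderiv]
    ext u
    rw [ContinuousLinearMap.comp_apply, hJdef, integralContinuousMapCLM_apply]
    simp [h2, hΦ.fderiv_eulerPullback_zero]
  · refine ⟨_, Filter.inter_mem hX0 hder, fun x hx g hgx => ?_⟩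
    obtain ⟨hxX, hxW, hxY, -, -⟩ := hx
    change fderiv 𝕜 (Φ g) x (J (Ξ x)) = J (Ξ (Φ g x))
    rw [show J (Ξ x) = _ from hxX, show J (Ξ (Φ g x)) = _ from hgx.1,
      ← ContinuousLinearMap.integral_comp_comm]
    · simp_rw [← hΦ.fderiv_apply_eulerPullback_mul g _ hxW]
      exact (integral_mul_right_eq_self
        (fun h => fderiv 𝕜 (Φ g) x (eulerPullback 𝕜 Φ h x)) g).symm
    · simp_rw [← hxY]
      exact (Ξ x).continuous.integrable_of_compactSpace μ
  · filter_upwards [hder] with x hx a a'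
    obtain ⟨hxW, hxY, hxd, hxD⟩ := hx
    -- In finite dimension, continuity of `T` may be tested on vectors, where it follows from the
    -- values of `DΞ` being continuous functions on `G`.
    set T : G → E →L[𝕜] E := fun g => fderiv 𝕜 (eulerPullback 𝕜 Φ g) x with hT
    have hTc : Continuous T := by
      rw [continuous_clm_apply]
      intro u
      simp_rw [hT, ← hxD]
      exact (fderiv 𝕜 Ξ x u).continuous
    have hTi : Integrable T μ := hTc.integrable_of_compactSpace μ
    have hYi : Integrable (fun g => Ξ x g) μ := (Ξ x).continuous.integrable_of_compactSpace μ
    have hDX : fderiv 𝕜 (fun x => J (Ξ x)) x = ∫ g, T g ∂μ := by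
      rw [hxd.fderiv]
      ext u
      rw [ContinuousLinearMap.integral_apply hTi, ContinuousLinearMap.comp_apply, hJdef,
        integralContinuousMapCLM_apply]
      simp_rw [hxD, hT]
    let L₀ : E →L[𝕜] 𝕜 := (β.flip a).flip a'
    let L₁ : (E →L[𝕜] E) →L[𝕜] 𝕜 :=
      ((β x).flip a').comp (ContinuousLinearMap.compL 𝕜 E E 𝕜 a)
    let L₂ : (E →L[𝕜] E) →L[𝕜] 𝕜 :=
      (β x a).comp (ContinuousLinearMap.compL 𝕜 E E 𝕜 a')
    -- For fixed `x` the Liouville identity is affine in the value and derivative of the field, so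
    -- it survives integration against a probability measure.
    have key : ∀ g, L₀ (Ξ x g) + β x a a' = L₁ (T g) + L₂ (T g) := fun g => by
      rw [hxY g]
      exact hΦ.liouville_eulerPullback β g (hP g) hxW a a'
    rw [hDX, hJdef, integralContinuousMapCLM_apply]
    change L₀ (∫ g, Ξ x g ∂μ) + β x a a' = L₁ (∫ g, T g ∂μ) + L₂ (∫ g, T g ∂μ)
    rw [← L₀.integral_comp_comm hYi, ← L₁.integral_comp_comm hTi, ← L₂.integral_comp_comm hTi,
      ← integral_add (L₁.integrable_comp hTi) (L₂.integrable_comp hTi)]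
    simp_rw [← key]
    rw [integral_add (L₀.integrable_comp hYi) (integrable_const _)]
    simp

end AveragedField

/-! ### Linearization of the action for a linear Poisson structure. -/

section EquivariantLinearization

set_option maxSynthPendingDepth 3

open Filter Topology

/-- A fixed point of a compact group of local transformations has arbitrarily small invariant open
neighbourhoods. -/
theorem exists_invariant_open_nhds {G E : Type*} [Group G] [TopologicalSpace G] [CompactSpace G]
    [TopologicalSpace E] {W : Set E} {Φ : G → E → E} (hW : IsOpen W)
    (hmaps : ∀ g, Set.MapsTo (Φ g) W W) (hone : ∀ x ∈ W, Φ 1 x = x)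
    (hmul : ∀ g h, ∀ x ∈ W, Φ (g * h) x = Φ g (Φ h x)) (hcont : ∀ g, ContinuousOn (Φ g) W)
    {x₀ : E} (hx₀ : x₀ ∈ W) (hfix : ∀ g, Φ g x₀ = x₀)
    (hjoint : ∀ g₀, ContinuousAt (fun p : G × E => Φ p.1 p.2) (g₀, x₀))
    {O : Set E} (hO : O ∈ 𝓝 x₀) :
    ∃ U, IsOpen U ∧ x₀ ∈ U ∧ U ⊆ O ∧ U ⊆ W ∧ ∀ g, Set.MapsTo (Φ g) U U := by
  have hev : ∀ᶠ x in 𝓝 x₀, ∀ g ∈ (Set.univ : Set G), Φ g x ∈ O := by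
    refine isCompact_univ.eventually_forall_of_forall_eventually fun g₀ _ => ?_
    have := hjoint g₀
    rw [ContinuousAt, hfix] at this
    have h2 := this.eventually hO
    rw [nhds_prod_eq] at h2 ⊢
    exact (Filter.eventually_swap_iff.1 h2)
  -- `S` is the set of points whose whole orbit lies in `O`: a neighbourhood of `x₀` by compactness,
  -- and stable under the group. Its interior is stable because each `Φ g` has the continuous
  -- inverse `Φ g⁻¹` on `W`.
  set S : Set E := {x | x ∈ W ∧ ∀ g, Φ g x ∈ O} with hS
  have hSx : S ∈ 𝓝 x₀ := by
    filter_upwards [hev, hW.mem_nhds hx₀] with x h1 h2 using ⟨h2, fun g => h1 g trivial⟩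
  refine ⟨interior S, isOpen_interior, mem_interior_iff_mem_nhds.2 hSx, fun x hx => ?_,
    fun x hx => (interior_subset hx).1, fun g x hx => ?_⟩
  · have h := interior_subset hx
    rw [← hone x h.1]
    exact h.2 1
  · have h := interior_subset hx
    rw [mem_interior_iff_mem_nhds] at hx ⊢
    have hinv : Φ g⁻¹ (Φ g x) = x := by rw [← hmul _ _ _ h.1, inv_mul_cancel, hone x h.1]
    have h1 : ContinuousAt (Φ g⁻¹) (Φ g x) := (hcont g⁻¹).continuousAt
      (hW.mem_nhds (hmaps g h.1))
    rw [ContinuousAt, hinv] at h1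
    filter_upwards [h1.eventually hx, hW.mem_nhds (hmaps g h.1)] with z hz hzW
    refine ⟨hzW, fun k => ?_⟩
    have h2 := hz.2 (k * g)
    rwa [← hmul _ _ _ hzW, mul_assoc, mul_inv_cancel, mul_one] at h2

variable {𝕜 : Type*} [RCLike 𝕜] {E : Type*} [NormedAddCommGroup E] [NormedSpace 𝕜 E]
  {G : Type*} [Group G] {W : Set E} {Φ : G → E → E}

/-- An analytic action of a compact group by Poisson maps of a linear Poisson structure `β` is
linearized by a Poisson diffeomorphism tangent to the identity. -/
theorem IsAnalyticActionFixingZero.exists_poisson_linearization [NormedSpace ℝ E]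
    [IsScalarTower ℝ 𝕜 E] [FiniteDimensional 𝕜 E]
    [TopologicalSpace G] [IsTopologicalGroup G] [CompactSpace G] [T2Space G]
    {V : Type*} [NormedAddCommGroup V] [NormedSpace ℝ V]
    (hΦ : IsAnalyticActionFixingZero 𝕜 W Φ) (hJ : IsJointlyAnalyticAtZero V Φ)
    (β : E →L[𝕜] (E →L[𝕜] 𝕜) →L[𝕜] (E →L[𝕜] 𝕜) →L[𝕜] 𝕜)
    (hP : ∀ h, ∀ x ∈ W, ∀ α α' : E →L[𝕜] 𝕜,
      β x (α.comp (fderiv 𝕜 (Φ h) x)) (α'.comp (fderiv 𝕜 (Φ h) x)) = β (Φ h x) α α')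
    {S : Set E} (hS : S ∈ 𝓝 (0 : E)) :
    ∃ ψ : OpenPartialHomeomorph E E, 0 ∈ ψ.source ∧ ψ 0 = 0 ∧ AnalyticOnNhd 𝕜 ψ ψ.source ∧
      AnalyticOnNhd 𝕜 ψ.symm ψ.target ∧ ψ.source ⊆ W ∧ ψ.target ⊆ S ∧
      (∀ g, Set.MapsTo (Φ g) ψ.source ψ.source) ∧
      (∀ x ∈ ψ.source, ∀ α α' : E →L[𝕜] 𝕜,
        β x (α.comp (fderiv 𝕜 ψ x)) (α'.comp (fderiv 𝕜 ψ x)) = β (ψ x) α α') ∧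
      ∀ g, ∀ x ∈ ψ.source, ψ (Φ g x) = fderiv 𝕜 (Φ g) 0 (ψ x) := by
  have : CompleteSpace E := FiniteDimensional.complete 𝕜 E
  obtain ⟨X, hXa, hX0, hX1, ⟨O, hO, hXΦ⟩, hXβ⟩ := exists_invariant_field hΦ hJ β hP
  obtain ⟨ψ, h0, hψ0, hψ, hψs, hψ1, hψX, hψsX⟩ :=
    exists_linearization_of_fderiv_eq_id (𝕜 := 𝕜) hXa hX0 hX1
  have hjoint : ∀ g₀, ContinuousAt (fun p : G × E => Φ p.1 p.2) (g₀, 0) := fun g₀ => by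
    obtain ⟨κ, hκ, f, hf, hfΦ⟩ := hJ g₀
    have hc : ContinuousAt (fun p : G × E => (κ p.1, p.2)) (g₀, 0) :=
      (hκ.comp (f := Prod.fst) (x := (g₀, (0 : E))) continuousAt_fst).prodMk continuousAt_snd
    exact (ContinuousAt.comp (f := fun p : G × E => (κ p.1, p.2)) (x := (g₀, (0 : E)))
      hf.continuousAt hc).congr (hfΦ.mono fun p hp => hp.symm)
  have hinv := fun {T : Set E} (hT : T ∈ 𝓝 (0 : E)) => exists_invariant_open_nhds hΦ.isOpen
    hΦ.mapsTo hΦ.one hΦ.mul (fun g => (hΦ.analytic g).continuousOn) hΦ.zero_mem hΦ.map_zero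
    hjoint hT
  obtain ⟨U, hUo, hU0, hUsub, hUW, hUinv⟩ := hinv (Filter.inter_mem
    (Filter.inter_mem hXa.eventually_analyticAt hXβ)
    (Filter.inter_mem hO (ψ.open_source.mem_nhds h0)))
  have h0t : (0 : E) ∈ ψ.target := by
    have := ψ.map_source h0
    rwa [hψ0] at this
  have hs0 : ψ.symm 0 = 0 := by
    conv_lhs => rw [← hψ0]
    exact ψ.left_inv h0
  -- The homogeneity argument runs along rays in the coordinates `ψ`, hence a ball in the target
  -- whose preimage lies in `U`.
  obtain ⟨ρ, hρ, hball⟩ : ∃ ρ > 0, Metric.ball (0 : E) ρ ⊆ ψ.target ∩ ψ.symm ⁻¹' U := by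
    refine Metric.mem_nhds_iff.1 (Filter.inter_mem (ψ.open_target.mem_nhds h0t) ?_)
    refine (ψ.continuousAt_symm h0t).preimage_mem_nhds ?_
    rw [hs0]
    exact hUo.mem_nhds hU0
  have hmemU : ∀ x ∈ ψ.source, ψ x ∈ Metric.ball (0 : E) ρ → x ∈ U := fun x hx hxρ => by
    have := (hball hxρ).2
    rwa [Set.mem_preimage, ψ.left_inv hx] at this
  have hρt : Metric.ball (0 : E) ρ ⊆ ψ.target := fun y hy => (hball hy).1
  have hlin : ∀ g, ∀ x ∈ ψ.source, ψ x ∈ Metric.ball (0 : E) ρ →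
      ψ (Φ g x) = fderiv 𝕜 (Φ g) 0 (ψ x) := by
    intro g x hx hxρ
    have hd : ∀ z ∈ U, HasFDerivAt (fun z => ψ (Φ g z))
        ((fderiv 𝕜 ψ (Φ g z)).comp (fderiv 𝕜 (Φ g) z)) z := fun z hz =>
      (hψ _ (hUsub (hUinv g hz)).2.2).differentiableAt.hasFDerivAt.comp z
        (hΦ.analytic g z (hUW hz)).differentiableAt.hasFDerivAt
    have key := eq_fderiv_zero_comp_of_fderiv_apply_eq (f := fun z => ψ (Φ g z)) h0 hψ0 hψs hψ1 hψ
      hψsX hρt (fun z hz hzρ => (hd z (hmemU z hz hzρ)).differentiableAt) (fun z hz hzρ => by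
        have hzU := hmemU z hz hzρ
        have hgz := hUsub (hUinv g hzU)
        rw [(hd z hzU).fderiv, ContinuousLinearMap.comp_apply,
          hXΦ z (hUsub hzU).2.1 g hgz.2.1]
        exact hψX _ hgz.2.2) hx hxρ
    simp only [(hd 0 hU0).fderiv, hΦ.map_zero, hψ1, ContinuousLinearMap.id_comp] at key
    exact key
  have hpois : ∀ x ∈ ψ.source, ψ x ∈ Metric.ball (0 : E) ρ → ∀ α α' : E →L[𝕜] 𝕜,
      β x (α.comp (fderiv 𝕜 ψ x)) (α'.comp (fderiv 𝕜 ψ x)) = β (ψ x) α α' := by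
    intro x hx hxρ α α'
    have key := eq_fderiv_zero_comp_of_fderiv_apply_eq
      (f := fun z => β z (α.comp (fderiv 𝕜 ψ z)) (α'.comp (fderiv 𝕜 ψ z))) h0 hψ0 hψs hψ1 hψ
      hψsX hρt (fun z hz _ => by
        obtain ⟨L, hL, -⟩ := hasFDerivAt_bivector_comp_fderiv β (hψ z hz) α α'
        exact hL.differentiableAt) (fun z hz hzρ => by
        have hzU := hUsub (hmemU z hz hzρ)
        exact fderiv_bivector_comp_fderiv_apply_eq β (hψ z hz) hzU.1.1.differentiableAt
          (by filter_upwards [ψ.open_source.mem_nhds hz] with w hw using hψX w hw)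
          hzU.1.2 α α') hx hxρ
    -- At `0` the second-derivative terms drop out since `β 0 = 0`, and `Dψ(0) = 1` leaves the form
    -- `β u α α'`.
    obtain ⟨L, hL, hLu⟩ := hasFDerivAt_bivector_comp_fderiv β (hψ 0 h0) α α'
    rw [hL.fderiv, hLu, hψ1] at key
    simpa using key
  have hψc : ContinuousAt ψ 0 := ψ.continuousAt h0
  -- The preimage of the ball need not be invariant, so a second shrinking provides the final
  -- invariant domain.
  obtain ⟨U', hUo', hU0', hUsub', hUW', hUinv'⟩ := hinv (Filter.inter_mem
    (ψ.open_source.mem_nhds h0) (Filter.inter_mem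
      (hψc.preimage_mem_nhds (by rw [hψ0]; exact Metric.ball_mem_nhds 0 hρ))
      (hψc.preimage_mem_nhds (by rw [hψ0]; exact hS))))
  have hsrc : (ψ.restrOpen U' hUo').source = U' := by
    rw [ψ.restrOpen_source]
    exact Set.inter_eq_right.2 fun x hx => (hUsub' hx).1
  refine ⟨ψ.restrOpen U' hUo', ?_⟩
  rw [hsrc]
  refine ⟨hU0', hψ0, fun x hx => hψ x (hUsub' hx).1, fun y hy => hψs y hy.1, hUW', fun y hy => ?_,
    hUinv', fun x hx => hpois x (hUsub' hx).1 (hUsub' hx).2.1,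
    fun g x hx => hlin g x (hUsub' hx).1 (hUsub' hx).2.1⟩
  have h1 := (ψ.restrOpen U' hUo').map_target hy
  rw [hsrc] at h1
  have h2 : ψ ((ψ.restrOpen U' hUo').symm y) = y := (ψ.restrOpen U' hUo').right_inv hy
  rw [← h2]
  exact (hUsub' h1).2.2

end EquivariantLinearization

/-! ### Coordinate brackets as bilinear forms, and transport through the chart. -/

namespace LinearAction

section Transport

set_option maxSynthPendingDepth 3

open Filter Topology

variable {𝕜 : Type*} [RCLike 𝕜] {n : ℕ}

/-- The bilinear form `(α, α') ↦ α(v) α'(w)` on the dual of `𝕜^n`. -/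
noncomputable def evalProd (v w : Fin n → 𝕜) :
    ((Fin n → 𝕜) →L[𝕜] 𝕜) →L[𝕜] ((Fin n → 𝕜) →L[𝕜] 𝕜) →L[𝕜] 𝕜 :=
  (ContinuousLinearMap.apply 𝕜 𝕜 v).smulRight (ContinuousLinearMap.apply 𝕜 𝕜 w)

/-- The bilinear form on the dual of `𝕜^n` with matrix `M`. -/
noncomputable def matrixForm (M : Matrix (Fin n) (Fin n) 𝕜) :
    ((Fin n → 𝕜) →L[𝕜] 𝕜) →L[𝕜] ((Fin n → 𝕜) →L[𝕜] 𝕜) →L[𝕜] 𝕜 :=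
  ∑ i, ∑ j, M i j • evalProd (Pi.single i 1) (Pi.single j 1)

theorem matrixForm_apply (M : Matrix (Fin n) (Fin n) 𝕜) (α α' : (Fin n → 𝕜) →L[𝕜] 𝕜) :
    matrixForm M α α' = ∑ i, ∑ j, M i j * α (Pi.single i 1) * α' (Pi.single j 1) := by
  simp [matrixForm, evalProd, sum_apply, mul_assoc]

theorem matrixForm_proj (M : Matrix (Fin n) (Fin n) 𝕜) (i j : Fin n) :
    matrixForm M (ContinuousLinearMap.proj i) (ContinuousLinearMap.proj j) = M i j := by
  simp [matrixForm_apply, Pi.single_apply]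

theorem eq_sum_smul_proj (α : (Fin n → 𝕜) →L[𝕜] 𝕜) :
    α = ∑ i, α (Pi.single i 1) • ContinuousLinearMap.proj i := by
  ext x
  conv_lhs => rw [← Finset.univ_sum_single x]
  rw [map_sum, sum_apply]
  refine Finset.sum_congr rfl fun i _ => ?_
  have : (Pi.single i (x i) : Fin n → 𝕜) = x i • Pi.single i 1 := by
    rw [← Pi.single_smul, smul_eq_mul, mul_one]
  rw [this, map_smul]
  simp [mul_comm]

/-- `D` sends the form with matrix `M` to the form with matrix `M'`. -/
def IsFormMap (M M' : Matrix (Fin n) (Fin n) 𝕜) (D : (Fin n → 𝕜) →L[𝕜] (Fin n → 𝕜)) : Prop :=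
  ∀ α α' : (Fin n → 𝕜) →L[𝕜] 𝕜, matrixForm M (α.comp D) (α'.comp D) = matrixForm M' α α'

theorem IsFormMap.comp {M M' M'' : Matrix (Fin n) (Fin n) 𝕜}
    {D D' : (Fin n → 𝕜) →L[𝕜] (Fin n → 𝕜)} (hD' : IsFormMap M' M'' D') (hD : IsFormMap M M' D) :
    IsFormMap M M'' (D'.comp D) := fun α α' => by
  rw [← ContinuousLinearMap.comp_assoc, ← ContinuousLinearMap.comp_assoc, hD, hD']

theorem IsFormMap.of_comp_eq_id {M M' : Matrix (Fin n) (Fin n) 𝕜}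
    {D D' : (Fin n → 𝕜) →L[𝕜] (Fin n → 𝕜)} (hD : IsFormMap M M' D)
    (h : D'.comp D = ContinuousLinearMap.id 𝕜 _) : IsFormMap M' M D' := fun α α' => by
  rw [← hD, ContinuousLinearMap.comp_assoc, ContinuousLinearMap.comp_assoc, h,
    ContinuousLinearMap.comp_id, ContinuousLinearMap.comp_id]

theorem bracket_eq_matrixForm (π : (Fin n → 𝕜) → Matrix (Fin n) (Fin n) 𝕜)
    (F : (Fin n → 𝕜) → (Fin n → 𝕜)) {x : Fin n → 𝕜} (hF : DifferentiableAt 𝕜 F x) (i j : Fin n) :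
    bracket π (fun y => F y i) (fun y => F y j) x =
      matrixForm (π x) ((ContinuousLinearMap.proj i).comp (fderiv 𝕜 F x))
        ((ContinuousLinearMap.proj j).comp (fderiv 𝕜 F x)) := by
  have h : ∀ i, fderiv 𝕜 (fun y => F y i) x =
      (ContinuousLinearMap.proj i).comp (fderiv 𝕜 F x) := fun i =>
    ((ContinuousLinearMap.proj (R := 𝕜) (φ := fun _ : Fin n => 𝕜) i).hasFDerivAt.comp x
      hF.hasFDerivAt).fderiv
  rw [matrixForm_apply, bracket, h, h]

/-- The covectors `proj i` span the dual, so by bilinearity the coordinate brackets determine the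
whole form. The coordinate-free side composes and inverts by the chain rule. -/
theorem bracket_eq_iff_isFormMap (π π' : (Fin n → 𝕜) → Matrix (Fin n) (Fin n) 𝕜)
    (F : (Fin n → 𝕜) → (Fin n → 𝕜)) {x : Fin n → 𝕜} (hF : DifferentiableAt 𝕜 F x) :
    (∀ i j, bracket π (fun y => F y i) (fun y => F y j) x = π' (F x) i j) ↔
      IsFormMap (π x) (π' (F x)) (fderiv 𝕜 F x) := by
  constructor
  · intro h α α'
    have hs : ∀ γ : (Fin n → 𝕜) →L[𝕜] 𝕜, γ.comp (fderiv 𝕜 F x) =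
        ∑ i, γ (Pi.single i 1) • (ContinuousLinearMap.proj i).comp (fderiv 𝕜 F x) := fun γ => by
      conv_lhs => rw [eq_sum_smul_proj γ]
      ext u
      simp [sum_apply]
    rw [hs α, hs α', matrixForm_apply (π' (F x))]
    simp only [map_sum, map_smul, sum_apply, smul_apply, smul_eq_mul, Finset.mul_sum]
    rw [Finset.sum_comm]
    refine Finset.sum_congr rfl fun i _ => Finset.sum_congr rfl fun j _ => ?_
    rw [← bracket_eq_matrixForm π F hF, h]
    ring
  · intro h i j
    rw [bracket_eq_matrixForm π F hF, h, matrixForm_proj]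

/-- The linear bivector field with structure constants `c`, as a linear family of bilinear forms. -/
noncomputable def linearForm (c : Fin n → Fin n → Fin n → 𝕜) :
    (Fin n → 𝕜) →L[𝕜] ((Fin n → 𝕜) →L[𝕜] 𝕜) →L[𝕜] ((Fin n → 𝕜) →L[𝕜] 𝕜) →L[𝕜] 𝕜 :=
  ∑ i, ∑ j, (∑ k, c i j k • ContinuousLinearMap.proj (R := 𝕜) (φ := fun _ : Fin n => 𝕜) k).smulRight
    (evalProd (Pi.single i 1) (Pi.single j 1))

theorem linearForm_apply (c : Fin n → Fin n → Fin n → 𝕜) (x : Fin n → 𝕜) :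
    linearForm c x = matrixForm (linearBivector c x) := by
  simp [linearForm, matrixForm, linearBivector, sum_apply]

namespace IsLocalAnalyticDiffeo

variable {χ ψ : OpenPartialHomeomorph (Fin n → 𝕜) (Fin n → 𝕜)}

theorem zero_mem_target (h : IsLocalAnalyticDiffeo χ) : 0 ∈ χ.target := by
  have := χ.map_source h.zero_mem
  rwa [h.map_zero] at this

theorem symm_zero (h : IsLocalAnalyticDiffeo χ) : χ.symm 0 = 0 := by
  conv_lhs => rw [← h.map_zero]
  exact χ.left_inv h.zero_mem

theorem symm (h : IsLocalAnalyticDiffeo χ) : IsLocalAnalyticDiffeo χ.symm :=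
  ⟨h.zero_mem_target, h.symm_zero, h.analytic_symm, by simpa using h.analytic⟩

theorem trans (h : IsLocalAnalyticDiffeo χ) (h' : IsLocalAnalyticDiffeo ψ) :
    IsLocalAnalyticDiffeo (χ.trans ψ) where
  zero_mem := by
    rw [χ.trans_source]
    exact ⟨h.zero_mem, by rw [Set.mem_preimage, h.map_zero]; exact h'.zero_mem⟩
  map_zero := by rw [χ.coe_trans, Function.comp_apply, h.map_zero, h'.map_zero]
  analytic := fun x hx => by
    rw [χ.trans_source] at hx
    exact (h'.analytic _ hx.2).comp (h.analytic x hx.1)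
  analytic_symm := fun y hy => by
    rw [χ.trans_target] at hy
    exact AnalyticAt.comp (g := χ.symm) (f := ψ.symm) (h.analytic_symm _ hy.2)
      (h'.analytic_symm y hy.1)

theorem fderiv_symm_comp (h : IsLocalAnalyticDiffeo χ) {x : Fin n → 𝕜} (hx : x ∈ χ.source) :
    (fderiv 𝕜 χ.symm (χ x)).comp (fderiv 𝕜 χ x) = ContinuousLinearMap.id 𝕜 _ := by
  have h1 : HasFDerivAt (fun z => χ.symm (χ z)) _ x :=
    (h.analytic_symm _ (χ.map_source hx)).differentiableAt.hasFDerivAt.comp x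
      (h.analytic x hx).differentiableAt.hasFDerivAt
  have h2 : (fun z => χ.symm (χ z)) =ᶠ[𝓝 x] fun z => z := by
    filter_upwards [χ.open_source.mem_nhds hx] with z hz using χ.left_inv hz
  rw [← h1.fderiv, h2.fderiv_eq, fderiv_fun_id]

end IsLocalAnalyticDiffeo

theorem isJointlyAnalyticAtZero_conj {V : Type*} [NormedAddCommGroup V] [NormedSpace ℝ V]
    {G : Type*} [TopologicalSpace G] {φ : G → (Fin n → 𝕜) → (Fin n → 𝕜)}
    (hφ : IsJointlyAnalyticAtZero V φ) (hfix : ∀ g, φ g 0 = 0)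
    {χ : OpenPartialHomeomorph (Fin n → 𝕜) (Fin n → 𝕜)} (hχ : IsLocalAnalyticDiffeo χ) :
    IsJointlyAnalyticAtZero V (fun g => χ ∘ φ g ∘ χ.symm) := by
  intro g₀
  obtain ⟨κ, hκ, f, hf, hfφ⟩ := hφ g₀
  have hf0 : f (κ g₀, 0) = 0 := by rw [← hfφ.self_of_nhds, hfix]
  have hs0 := hχ.symm_zero
  refine ⟨κ, hκ, fun p => χ (f (p.1, χ.symm p.2)), ?_, ?_⟩
  · have h1 : AnalyticAt ℝ (fun p : V × (Fin n → 𝕜) => (p.1, χ.symm p.2)) (κ g₀, 0) :=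
      analyticAt_fst.prod (AnalyticAt.comp (g := χ.symm) (f := Prod.snd)
        (hχ.analytic_symm 0 hχ.zero_mem_target).restrictScalars analyticAt_snd)
    have h2 : AnalyticAt ℝ (fun p : V × (Fin n → 𝕜) => f (p.1, χ.symm p.2)) (κ g₀, 0) :=
      AnalyticAt.comp (g := f) (by rw [hs0]; exact hf) h1
    refine AnalyticAt.comp (g := χ) ?_ h2
    simp only [hs0, hf0]
    exact (hχ.analytic 0 hχ.zero_mem).restrictScalars
  · have hc : ContinuousAt (fun p : G × (Fin n → 𝕜) => (p.1, χ.symm p.2)) (g₀, 0) :=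
      continuousAt_fst.prodMk (ContinuousAt.comp (g := χ.symm) (f := Prod.snd)
        (χ.continuousAt_symm hχ.zero_mem_target) continuousAt_snd)
    rw [ContinuousAt, hs0] at hc
    filter_upwards [hc.eventually hfφ] with p hp
    simp only [Function.comp_apply]
    rw [hp]

variable {V : Type*} [NormedAddCommGroup V] [NormedSpace ℝ V]
  {G : Type*} [TopologicalSpace G] [ChartedSpace V G] [Group G]
  {Ω : Set (Fin n → 𝕜)} {π : (Fin n → 𝕜) → Matrix (Fin n) (Fin n) 𝕜}
  {φ : G → (Fin n → 𝕜) → (Fin n → 𝕜)}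

theorem IsAnalyticPoissonAction.isJointlyAnalyticAtZero
    (hφ : IsAnalyticPoissonAction (V := V) Ω π φ) (hΩ : IsOpen Ω) (h0 : 0 ∈ Ω) :
    IsJointlyAnalyticAtZero V φ := by
  intro g₀
  have h1 : ContMDiffAt (𝓘(ℝ, V).prod 𝓘(ℝ, Fin n → 𝕜)) 𝓘(ℝ, Fin n → 𝕜) ω
      (fun p : G × (Fin n → 𝕜) => φ p.1 p.2) (g₀, 0) :=
    hφ.analytic.contMDiffAt (prod_mem_nhds univ_mem (hΩ.mem_nhds h0))
  have h2 := (contMDiffAt_iff.1 h1).2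
  refine ⟨chartAt V g₀, (chartAt V g₀).continuousAt (mem_chart_source V g₀),
    fun p => φ ((chartAt V g₀).symm p.1) p.2, ?_, ?_⟩
  · refine ContDiffAt.analyticAt (𝕜 := ℝ) ?_
    rw [← contDiffWithinAt_univ]
    convert! h2 using 1
    simp
  · have : ∀ᶠ p in 𝓝 (g₀, (0 : Fin n → 𝕜)), p.1 ∈ (chartAt V g₀).source :=
      continuousAt_fst.eventually
        ((chartAt V g₀).open_source.mem_nhds (mem_chart_source V g₀))
    filter_upwards [this] with p hp
    rw [(chartAt V g₀).left_inv hp]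

end Transport

end LinearAction

/-! ### The theorem in the original coordinates. -/

theorem proposition4p2 {𝕜 : Type*} [RCLike 𝕜] {n : ℕ}
    {V : Type*} [NormedAddCommGroup V] [NormedSpace ℝ V] [FiniteDimensional ℝ V]
    {G : Type*} [TopologicalSpace G] [ChartedSpace V G] [Group G] [LieGroup 𝓘(ℝ, V) ω G]
    [T2Space G] [CompactSpace G]
    (Ω : Set (Fin n → 𝕜)) (hΩ : IsOpen Ω) (h0 : 0 ∈ Ω)
    (π : (Fin n → 𝕜) → Matrix (Fin n) (Fin n) 𝕜) (hπ : LinearAction.IsAnalyticPoisson Ω π)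
    (φ : G → (Fin n → 𝕜) → (Fin n → 𝕜))
    (hφ : LinearAction.IsAnalyticPoissonAction (V := V) Ω π φ)
    (hfix : ∀ g, φ g 0 = 0)
    (χ : OpenPartialHomeomorph (Fin n → 𝕜) (Fin n → 𝕜))
    (hχ : LinearAction.IsLinearizingChart Ω π χ) :
    ∃ ψ : OpenPartialHomeomorph (Fin n → 𝕜) (Fin n → 𝕜),
      LinearAction.IsLocalAnalyticDiffeo ψ ∧
      ψ.source ⊆ χ.source ∧ ψ.target ⊆ χ.source ∧
      LinearAction.IsPoissonMapOn π π ψ.source ψ ∧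
      (∀ g, Set.MapsTo (φ g) ψ.source ψ.source) ∧
      ∀ g, ∀ x ∈ ψ.source,
        χ (ψ (φ g x)) = fderiv 𝕜 (χ ∘ φ g ∘ χ.symm) 0 (χ (ψ x)) := by
  have hG : IsTopologicalGroup G := topologicalGroup_of_lieGroup 𝓘(ℝ, V) ω
  obtain ⟨c, hc⟩ := hχ.linear
  have hd := hχ.diffeo
  have hJφ := hφ.isJointlyAnalyticAtZero hΩ h0
  obtain ⟨U, hUo, hU0, hUχ, hUΩ, hUinv⟩ := exists_invariant_open_nhds hΩ hφ.mapsTo hφ.one hφ.mul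
    (fun g => (hφ.analytic_each g).continuousOn) h0 hfix
    (fun g₀ => (hφ.analytic.contMDiffAt
      (prod_mem_nhds Filter.univ_mem (hΩ.mem_nhds h0))).continuousAt)
    (χ.open_source.mem_nhds hd.zero_mem)
  -- `W` is the image under `χ` of an invariant neighbourhood inside the chart domain, so the
  -- conjugated maps form a genuine action on it.
  set W : Set (Fin n → 𝕜) := χ.symm.source ∩ χ.symm ⁻¹' U with hW
  have hWmem : ∀ x ∈ U, χ x ∈ W := fun x hx =>
    ⟨χ.map_source (hUχ hx), by rw [Set.mem_preimage, χ.left_inv (hUχ hx)]; exact hx⟩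
  have hΦ : IsAnalyticActionFixingZero 𝕜 W (fun g => χ ∘ φ g ∘ χ.symm) :=
    { isOpen := χ.symm.isOpen_inter_preimage hUo
      zero_mem := ⟨hd.zero_mem_target, by rw [Set.mem_preimage, hd.symm_zero]; exact hU0⟩
      mapsTo := fun g y hy => hWmem _ (hUinv g hy.2)
      one := fun y hy => by
        simp only [Function.comp_apply]
        rw [hφ.one _ (hUΩ hy.2), χ.right_inv hy.1]
      mul := fun g h y hy => by
        simp only [Function.comp_apply]
        rw [χ.left_inv (hUχ (hUinv h hy.2)), hφ.mul g h _ (hUΩ hy.2)]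
      analytic := fun g y hy => by
        have h1 : AnalyticAt 𝕜 (fun y => φ g (χ.symm y)) y :=
          (hφ.analytic_each g _ (hUΩ hy.2)).comp (hd.analytic_symm y hy.1)
        exact AnalyticAt.comp (g := χ) (hd.analytic _ (hUχ (hUinv g hy.2))) h1
      map_zero := fun g => by
        simp only [Function.comp_apply]
        rw [hd.symm_zero, hfix, hd.map_zero] }
  have hχform : ∀ x ∈ χ.source,
      LinearAction.IsFormMap (π x) (LinearAction.linearBivector c (χ x)) (fderiv 𝕜 χ x) :=
    fun x hx => (LinearAction.bracket_eq_iff_isFormMap _ _ _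
      (hd.analytic x hx).differentiableAt).1 (hc x hx)
  have hχsform : ∀ x ∈ χ.source,
      LinearAction.IsFormMap (LinearAction.linearBivector c (χ x)) (π x)
        (fderiv 𝕜 χ.symm (χ x)) := fun x hx => (hχform x hx).of_comp_eq_id (hd.fderiv_symm_comp hx)
  have hP : ∀ g, ∀ y ∈ W, ∀ α α' : (Fin n → 𝕜) →L[𝕜] 𝕜,
      LinearAction.linearForm c y (α.comp (fderiv 𝕜 (χ ∘ φ g ∘ χ.symm) y))
        (α'.comp (fderiv 𝕜 (χ ∘ φ g ∘ χ.symm) y)) =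
      LinearAction.linearForm c ((χ ∘ φ g ∘ χ.symm) y) α α' := by
    intro g y hy
    have hgy := hUinv g hy.2
    have h1 : HasFDerivAt (χ ∘ φ g ∘ χ.symm) ((fderiv 𝕜 χ (φ g (χ.symm y))).comp
        ((fderiv 𝕜 (φ g) (χ.symm y)).comp (fderiv 𝕜 χ.symm y))) y :=
      (hd.analytic _ (hUχ hgy)).differentiableAt.hasFDerivAt.comp y
        ((hφ.analytic_each g _ (hUΩ hy.2)).differentiableAt.hasFDerivAt.comp y
          (hd.analytic_symm y hy.1).differentiableAt.hasFDerivAt)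
    have h2 := hχsform _ (hUχ hy.2)
    rw [χ.right_inv hy.1] at h2
    have h3 := (LinearAction.bracket_eq_iff_isFormMap _ _ _
      (hφ.analytic_each g _ (hUΩ hy.2)).differentiableAt).1 (hφ.poisson g _ (hUΩ hy.2))
    have h4 := (hχform _ (hUχ hgy)).comp (h3.comp h2)
    rw [h1.fderiv, LinearAction.linearForm_apply, LinearAction.linearForm_apply]
    exact h4
  -- The target of `ψ` is kept inside `χ.target`, so that `χ⁻¹ ∘ ψ ∘ χ` needs no further restriction
  -- of its domain.
  obtain ⟨ψ, hψ0, hψz, hψa, hψsa, hψW, hψt, hψinv, hψP, hψlin⟩ :=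
    hΦ.exists_poisson_linearization (LinearAction.isJointlyAnalyticAtZero_conj hJφ hfix hd)
      (LinearAction.linearForm c) hP
      (χ.open_target.mem_nhds hd.zero_mem_target)
  have hψd : LinearAction.IsLocalAnalyticDiffeo ψ := ⟨hψ0, hψz, hψa, hψsa⟩
  have hsrc : ∀ x, x ∈ ((χ.trans ψ).trans χ.symm).source ↔ x ∈ χ.source ∧ χ x ∈ ψ.source := by
    intro x
    simp only [OpenPartialHomeomorph.trans_source, Set.mem_inter_iff, Set.mem_preimage,
      OpenPartialHomeomorph.coe_trans, Function.comp_apply]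
    exact ⟨fun h => h.1, fun h => ⟨h, hψt (ψ.map_source h.2)⟩⟩
  have hxU : ∀ x ∈ χ.source, χ x ∈ ψ.source → x ∈ U := fun x hx hx' => by
    have := (hψW hx').2
    rwa [Set.mem_preimage, χ.left_inv hx] at this
  have hψχ : ∀ x, χ x ∈ ψ.source → χ (χ.symm (ψ (χ x))) = ψ (χ x) := fun x hx =>
    χ.right_inv (hψt (ψ.map_source hx))
  have hconj : ∀ g, ∀ x ∈ χ.source, (χ ∘ φ g ∘ χ.symm) (χ x) = χ (φ g x) := fun g x hx => by
    simp only [Function.comp_apply, χ.left_inv hx]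
  have hmaps : ∀ g, ∀ x ∈ χ.source, χ x ∈ ψ.source → χ (φ g x) ∈ ψ.source :=
    fun g x hx hx' => by
      rw [← hconj g x hx]
      exact hψinv g hx'
  refine ⟨(χ.trans ψ).trans χ.symm, (hd.trans hψd).trans hd.symm, fun x hx => ((hsrc x).1 hx).1,
    fun y hy => ?_, fun x hx => ?_, fun g x hx => ?_, fun g x hx => ?_⟩
  · rw [OpenPartialHomeomorph.trans_target] at hy
    exact hy.1
  · have hdiff := ((hd.trans hψd).trans hd.symm).analytic x hx
    obtain ⟨hx1, hx2⟩ := (hsrc x).1 hx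
    refine (LinearAction.bracket_eq_iff_isFormMap π π _ hdiff.differentiableAt).2 ?_
    have hψt' := hψt (ψ.map_source hx2)
    have h1 : HasFDerivAt ((χ.trans ψ).trans χ.symm) ((fderiv 𝕜 χ.symm (ψ (χ x))).comp
        ((fderiv 𝕜 ψ (χ x)).comp (fderiv 𝕜 χ x))) x :=
      HasFDerivAt.comp (g := χ.symm) x
        (hd.analytic_symm _ hψt').differentiableAt.hasFDerivAt
        ((hψa _ hx2).differentiableAt.hasFDerivAt.comp x
          (hd.analytic x hx1).differentiableAt.hasFDerivAt)
    have h2 : LinearAction.IsFormMap (LinearAction.linearBivector c (χ x))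
        (LinearAction.linearBivector c (ψ (χ x)))
        (fderiv 𝕜 ψ (χ x)) := fun α α' => by
      rw [← LinearAction.linearForm_apply, ← LinearAction.linearForm_apply]
      exact hψP _ hx2 α α'
    have h3 := hχsform _ (χ.map_target hψt')
    rw [χ.right_inv hψt'] at h3
    rw [h1.fderiv]
    exact h3.comp (h2.comp (hχform x hx1))
  · obtain ⟨hx1, hx2⟩ := (hsrc x).1 hx
    exact (hsrc _).2 ⟨hUχ (hUinv g (hxU x hx1 hx2)), hmaps g x hx1 hx2⟩
  · obtain ⟨hx1, hx2⟩ := (hsrc x).1 hx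
    change χ (χ.symm (ψ (χ (φ g x)))) = fderiv 𝕜 _ 0 (χ (χ.symm (ψ (χ x))))
    rw [hψχ _ hx2, hψχ _ (hmaps g x hx1 hx2), ← hconj g x hx1]
    exact hψlin g _ hx2
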